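/- A function $f_0:\mathbb{R}\to[0,\infty)$ that is a probability density with respect to Lebesgue measure and is absolutely continuous on every compact interval is called a locally absolutely continuous density. For $\beta\in[1,2]$ and $L,r>0$, let $\tilde{\mathcal F}_{\beta,L,r}$ be the set of all positive, locally absolutely continuous densities $f_0$ on $\mathbb{R}$ (not necessarily log-concave) whose score function $\psi_0:=(\log f_0)'$ (defined everywhere if $\beta>1$, and Lebesgue almost everywhere if $\beta=1$) satisfies $$|\psi_0(x)-\psi_0(y)|\le L|x-y|^{\beta-1}$$ for all $x,y\in\mathbb{R}$ at which it is defined, and whose Fisher information satisfies $i(f_0):=\int_{-\infty}^{\infty}\psi_0^2f_0\le r$. For $n\in\mathbb{N}=\{1,2,\dots\}$, let $\hat\Psi_n$ be the set of all jointly measurable functions $\hat\psi_n:\mathbb{R}\times\mathbb{R}^n\to\mathbb{R}$, and let $X_1,\dots,X_n$ be independent random variables with density $f_0$. Write $$\mathcal{L}_{f_0}(\hat\psi_n):=\int_{-\infty}^{\infty}\bigl(\hat\psi_n(x;X_1,\dots,X_n)-\psi_0(x)\bigr)^2f_0(x)\,\mathrm{d}x\in[0,\infty].$$ For a class $\mathcal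 G$ of such densities and $\delta\in(0,1]$, define the minimax risk and the minimax $(1-\delta)$th quantile over $\mathcal G$ by $$\mathcal M_n(\mathcal G):=\inf_{\hat\psi_n\in\hat\Psi_n}\sup_{f_0\in\mathcal G}\mathbb{E}_{f_0}\bigl\{\mathcal{L}_{f_0}(\hat\psi_n)\bigr\},$$ $$\mathcal M_n(\delta,\mathcal G):=\inf_{\hat\psi_n\in\hat\Psi_n}\sup_{f_0\in\mathcal G}\inf\bigl\{t\in[0,\infty):\mathbb{P}_{f_0}\bigl(\mathcal{L}_{f_0}(\hat\psi_n)\le t\bigr)\ge1-\delta\bigr\},$$ with $\inf\emptyset:=\infty$. Then for every $\beta\in[1,2]$ there is a constant $c_\beta>0$, depending only on $\beta$, such that for all $L,r>0$, all $n\in\mathbb{N}$ and all $\delta\in(0,1/4)$, with $r':=\min\{r,L^{2/\beta}\}$, $$\mathcal M_n(\delta,\tilde{\mathcal F}_{\beta,L,r})\ge c_\beta\, r'\min\biggl\{\Bigl(\frac{L^{2/\beta}}{r'}\cdot\frac1n\Bigr)^{\frac{2(\beta-1)}{2\beta+1}}+\Bigl(\frac{L^{2/\beta}}{r'}\cdot\frac{\log(1/\delta)}{n}\Bigr)^{\frac{\beta-1}{\beta}},\,1\biggr\},$$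 $$\mathcal M_n(\tilde{\mathcal F}_{\beta,L,r})\ge c_\beta\, r'\min\biggl\{\Bigl(\frac{L^{2/\beta}}{r'}\cdot\frac1n\Bigr)^{\frac{2(\beta-1)}{2\beta+1}},\,1\biggr\}.$$ -/

import Mathlib

open MeasureTheory
open scoped ENNReal NNReal

/-- `f` is a probability density on `ℝ` with respect to Lebesgue measure. -/
def IsDensity (f : ℝ → ℝ) : Prop :=
  Measurable f ∧ (∀ x, 0 ≤ f x) ∧ ∫⁻ x, ENNReal.ofReal (f x) = 1

/-- Local absolute continuity on `ℝ`: absolute continuity on every compact interval. -/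
def LocallyAbsCont (f : ℝ → ℝ) : Prop :=
  ∀ a b : ℝ, AbsolutelyContinuousOnInterval f a b

/-- The score function `(log f)'`. For a positive, locally absolutely continuous `f` the derivative
exists at Lebesgue almost every point; the value at the other points is immaterial, since the score
is only used under integrals, or at points where the derivative exists. -/
noncomputable def score (f : ℝ → ℝ) (x : ℝ) : ℝ :=
  deriv (fun y => Real.log (f y)) x

/-- The Fisher information for location, `∫ ψ₀² f₀`, as an extended nonnegative real. -/
noncomputable def fisherInfo (f : ℝ → ℝ) : ℝ≥0∞ :=
  ∫⁻ x, ENNReal.ofReal (score f x ^ 2 * f x)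

/-- The class of locally absolutely continuous densities on `ℝ` whose score function satisfies
`|ψ₀(x) - ψ₀(y)| ≤ L |x - y| ^ (β - 1)` for all `x, y`. The density is positive, so that its
logarithm is real valued. The score has to be defined everywhere when `β > 1`; when `β = 1` it is
defined almost everywhere, and the condition ranges over the points where it is defined. -/
def holderScoreClass (β L : ℝ) : Set (ℝ → ℝ) :=
  {f | IsDensity f ∧ (∀ x, 0 < f x) ∧ LocallyAbsCont f ∧
    (1 < β → Differentiable ℝ (fun y => Real.log (f y))) ∧
    ∀ x y : ℝ, DifferentiableAt ℝ (fun z => Real.log (f z)) x →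
      DifferentiableAt ℝ (fun z => Real.log (f z)) y →
      |score f x - score f y| ≤ L * |x - y| ^ (β - 1)}

/-- The subclass with Fisher information at most `r`. -/
def holderScoreFisherClass (β L r : ℝ) : Set (ℝ → ℝ) :=
  {f | f ∈ holderScoreClass β L ∧ fisherInfo f ≤ ENNReal.ofReal r}

/-- The law of `n` independent observations with density `f`. -/
noncomputable def sampleLaw (n : ℕ) (f : ℝ → ℝ) : Measure (Fin n → ℝ) :=
  Measure.pi fun _ => (volume : Measure ℝ).withDensity fun x => ENNReal.ofReal (f x)

/-- The loss `∫ (ψ - ψ₀)² f₀` of a real function `ψ`, as an extended nonnegative real. -/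
noncomputable def scoreLoss (ψ f : ℝ → ℝ) : ℝ≥0∞ :=
  ∫⁻ x, ENNReal.ofReal ((ψ x - score f x) ^ 2 * f x)

/-- The estimators of the score from `n` observations: jointly measurable functions of the point
`x` and the sample. -/
def ScoreEstimator (n : ℕ) : Type :=
  {ψ : ℝ × (Fin n → ℝ) → ℝ // Measurable ψ}

/-- The loss incurred by an estimator on the sample `X`. -/
noncomputable def ScoreEstimator.loss {n : ℕ} (ψ : ScoreEstimator n) (f : ℝ → ℝ)
    (X : Fin n → ℝ) : ℝ≥0∞ :=
  scoreLoss (fun x => ψ.1 (x, X)) f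

/-- The minimax risk of score estimation over `G` (infimum over estimators of the worst-case
expected loss). -/
noncomputable def minimaxRisk (n : ℕ) (G : Set (ℝ → ℝ)) : ℝ≥0∞ :=
  ⨅ ψ : ScoreEstimator n, ⨆ f ∈ G, ∫⁻ X, ψ.loss f X ∂(sampleLaw n f)

/-- The `(1 - δ)`th quantile of the loss: the infimum of the `t ∈ [0, ∞)` such that the loss is at
most `t` with probability at least `1 - δ` (and `∞` if there is no such `t`). -/
noncomputable def lossQuantile {n : ℕ} (δ : ℝ) (ψ : ScoreEstimator n) (f : ℝ → ℝ) : ℝ≥0∞ :=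
  ⨅ (t : ℝ≥0) (_ : ENNReal.ofReal (1 - δ) ≤ sampleLaw n f {X | ψ.loss f X ≤ (t : ℝ≥0∞)}),
    (t : ℝ≥0∞)

/-- The minimax `(1 - δ)`th quantile of score estimation over `G`. -/
noncomputable def minimaxQuantile (n : ℕ) (δ : ℝ) (G : Set (ℝ → ℝ)) : ℝ≥0∞ :=
  ⨅ ψ : ScoreEstimator n, ⨆ f ∈ G, lossQuantile δ ψ f

/-!
The hardest densities are perturbations of a flat base with Cauchy tails. The base has a plateau of
length `1 / σ`, where `σ ^ β = L`, carrying a proportion of order `r' / σ ^ 2` of the mass. On the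
plateau the logarithm of the density is perturbed by `m` signed bumps on disjoint bins; the Hölder
condition caps their height at order `m ^ (-β)`. Each bump is odd about the centre of its bin, so
the total mass does not depend on the signs.

With independent signs, Assouad's lemma yields the nonparametric rate: `m` is the smallest number of
bins for which one sign cannot be read off the sample. If all signs agree, there are only two
densities `p` and `q`, and confusing them costs the whole score. Le Cam's bound
`(∫ √(p q)) ^ (2 n) ≤ 2 α` on the sum `α` of the errors of a test shows that `m` then need only be
large enough for `α` to exceed a multiple of `δ`, which yields the `log (1 / δ)` term. Markov's
inequality at a fixed level turns the quantile bound into the risk bound.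
-/

section Hellinger

variable {α : Type*} [MeasurableSpace α] {μ : Measure α} {f g : α → ℝ≥0∞}

/-- The Hellinger affinity `∫ √(f g) dμ` of two densities with respect to `μ`; its powers bound
the error probabilities of tests from below. -/
noncomputable def hellingerAffinity (μ : Measure α) (f g : α → ℝ≥0∞) : ℝ≥0∞ :=
  ∫⁻ x, (f x * g x) ^ (1 / 2 : ℝ) ∂μ

lemma hellingerAffinity_le_rpow_mul_rpow (hf : AEMeasurable f μ) (hg : AEMeasurable g μ) :
    hellingerAffinity μ f g ≤ (∫⁻ x, f x ∂μ) ^ (1 / 2 : ℝ) * (∫⁻ x, g x ∂μ) ^ (1 / 2 : ℝ) := by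
  simp only [hellingerAffinity, ENNReal.mul_rpow_of_nonneg _ _ (one_half_pos (α := ℝ)).le]
  exact ENNReal.lintegral_mul_norm_pow_le hf hg (by norm_num) (by norm_num) (by norm_num)

lemma hellingerAffinity_restrict_le_sqrt (hf : AEMeasurable f μ) (hg : AEMeasurable g μ)
    [IsFiniteMeasure (μ.withDensity f)] [IsFiniteMeasure (μ.withDensity g)]
    {S : Set α} (hS : MeasurableSet S) :
    hellingerAffinity (μ.restrict S) f g ≤
      ENNReal.ofReal √((μ.withDensity f).real S * (μ.withDensity g).real S) := by
  refine (hellingerAffinity_le_rpow_mul_rpow hf.restrict hg.restrict).trans_eq ?_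
  rw [← withDensity_apply f hS, ← withDensity_apply g hS, Real.sqrt_eq_rpow,
    ← ENNReal.ofReal_rpow_of_nonneg (by positivity) (by norm_num),
    ENNReal.ofReal_mul (by positivity), ENNReal.mul_rpow_of_nonneg _ _ (by norm_num),
    ofReal_measureReal, ofReal_measureReal]

lemma sqrt_mul_add_sqrt_compl_mul_le {a b : ℝ} (ha : a ∈ Set.Icc 0 1) (hb : b ∈ Set.Icc 0 1) :
    √(a * b) + √((1 - a) * (1 - b)) ≤ √((a + (1 - b)) * (2 - (a + (1 - b)))) := by
  obtain ⟨ha0, ha1⟩ := ha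
  obtain ⟨hb0, hb1⟩ := hb
  refine Real.le_sqrt_of_sq_le ?_
  rw [Real.sqrt_mul ha0, Real.sqrt_mul (sub_nonneg.2 ha1)]
  nlinarith [Real.sq_sqrt ha0, Real.sq_sqrt hb0, Real.sq_sqrt (sub_nonneg.2 ha1),
    Real.sq_sqrt (sub_nonneg.2 hb1), sq_nonneg (√a * √(1 - a) - √b * √(1 - b))]

lemma hellingerAffinity_le_sqrt_test_errors (hf : AEMeasurable f μ) (hg : AEMeasurable g μ)
    [IsProbabilityMeasure (μ.withDensity f)] [IsProbabilityMeasure (μ.withDensity g)]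
    {S : Set α} (hS : MeasurableSet S) :
    hellingerAffinity μ f g ≤ ENNReal.ofReal √(
      ((μ.withDensity f).real S + (μ.withDensity g).real Sᶜ) *
        (2 - ((μ.withDensity f).real S + (μ.withDensity g).real Sᶜ))) := by
  calc
    _ = hellingerAffinity (μ.restrict S) f g + hellingerAffinity (μ.restrict Sᶜ) f g :=
      (lintegral_add_compl _ hS).symm
    _ ≤ _ := add_le_add (hellingerAffinity_restrict_le_sqrt hf hg hS)
      (hellingerAffinity_restrict_le_sqrt hf hg hS.compl)
    _ ≤ _ := by
      rw [← ENNReal.ofReal_add (by positivity) (by positivity), probReal_compl_eq_one_sub hS,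
        probReal_compl_eq_one_sub hS]
      exact ENNReal.ofReal_le_ofReal (sqrt_mul_add_sqrt_compl_mul_le
        ⟨measureReal_nonneg, measureReal_le_one⟩ ⟨measureReal_nonneg, measureReal_le_one⟩)

end Hellinger

section SampleLaw

lemma lintegral_pi_prod_eq_prod {n : ℕ} {α : Type*} [MeasurableSpace α]
    (μ : Fin n → Measure α) [∀ i, SigmaFinite (μ i)] (g : Fin n → α → ℝ≥0∞)
    (hg : ∀ i, Measurable (g i)) :
    ∫⁻ x, ∏ i, g i (x i) ∂(Measure.pi μ) = ∏ i, ∫⁻ x, g i x ∂(μ i) := by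
  induction n with
  | zero => simp
  | succ n ih =>
    rw [← (measurePreserving_piFinSuccAbove μ 0).symm.lintegral_comp_emb
      (MeasurableEquiv.measurableEmbedding _)]
    simp only [Fin.prod_univ_succ, MeasurableEquiv.piFinSuccAbove_symm_apply, Fin.insertNthEquiv,
      Fin.zero_succAbove, Equiv.coe_fn_mk, Fin.insertNth_zero, Fin.cons_zero, Fin.cons_succ,
      cast_eq]
    rw [lintegral_prod_mul (f := g 0)
      (g := fun y : Fin n → α => ∏ i, g i.succ (y i)) (hg 0).aemeasurable
      (Finset.measurable_prod _ fun i _ => (hg _).comp (measurable_pi_apply i)).aemeasurable,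
      ih (fun i => μ i.succ) (fun i => g i.succ) (fun i => hg _)]

lemma hellingerAffinity_pi {n : ℕ} {α : Type*} [MeasurableSpace α]
    (μ : Fin n → Measure α) [∀ i, SigmaFinite (μ i)] {f g : Fin n → α → ℝ≥0∞}
    (hf : ∀ i, Measurable (f i)) (hg : ∀ i, Measurable (g i)) :
    hellingerAffinity (Measure.pi μ) (fun x => ∏ i, f i (x i)) (fun x => ∏ i, g i (x i)) =
      ∏ i, hellingerAffinity (μ i) (f i) (g i) := by
  simp only [hellingerAffinity, ← Finset.prod_mul_distrib,
    ← ENNReal.prod_rpow_of_nonneg (one_half_pos (α := ℝ)).le]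
  exact lintegral_pi_prod_eq_prod μ (fun i x => (f i x * g i x) ^ (1 / 2 : ℝ))
    fun i => ((hf i).mul (hg i)).pow_const _

lemma pi_withDensity_eq_withDensity_prod {n : ℕ} {α : Type*}
    [MeasurableSpace α] (μ : Fin n → Measure α) [∀ i, SigmaFinite (μ i)]
    {f : Fin n → α → ℝ≥0∞} (hf : ∀ i, Measurable (f i))
    [∀ i, SigmaFinite ((μ i).withDensity (f i))] :
    Measure.pi (fun i => (μ i).withDensity (f i)) =
      (Measure.pi μ).withDensity fun x => ∏ i, f i (x i) := by
  refine Measure.pi_eq fun s hs => ?_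
  have indicator_eq : ∀ x, (Set.univ.pi s).indicator (fun x => ∏ i, f i (x i)) x =
      ∏ i, (s i).indicator (f i) (x i) := fun x => by
    classical
    simp only [Set.indicator_apply, Finset.prod_ite_zero, Set.mem_univ_pi, Finset.mem_univ,
      true_implies]
  simp only [withDensity_apply _ (MeasurableSet.univ_pi hs), withDensity_apply _ (hs _),
    ← lintegral_indicator (MeasurableSet.univ_pi hs), ← lintegral_indicator (hs _), indicator_eq]
  exact lintegral_pi_prod_eq_prod μ (fun i => (s i).indicator (f i))
    fun i => (hf i).indicator (hs i)

lemma IsDensity.isProbabilityMeasure_withDensity {f : ℝ → ℝ} (hf : IsDensity f) :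
    IsProbabilityMeasure ((volume : Measure ℝ).withDensity fun x => ENNReal.ofReal (f x)) :=
  ⟨by rw [withDensity_apply _ MeasurableSet.univ, Measure.restrict_univ, hf.2.2]⟩

lemma IsDensity.isProbabilityMeasure_sampleLaw {f : ℝ → ℝ} (hf : IsDensity f) (n : ℕ) :
    IsProbabilityMeasure (sampleLaw n f) := by
  have := hf.isProbabilityMeasure_withDensity
  unfold sampleLaw
  infer_instance

lemma IsDensity.sampleLaw_eq_withDensity {f : ℝ → ℝ} (hf : IsDensity f) (n : ℕ) :
    sampleLaw n f =
      (volume : Measure (Fin n → ℝ)).withDensity fun X => ∏ i, ENNReal.ofReal (f (X i)) :=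
  have := hf.isProbabilityMeasure_withDensity
  pi_withDensity_eq_withDensity_prod (fun _ => volume) fun _ => hf.1.ennreal_ofReal

lemma IsDensity.affinity_pow_sq_le_test_errors {p q : ℝ → ℝ} (hp : IsDensity p)
    (hq : IsDensity q) {ρ : ℝ} (hρ : 0 ≤ ρ)
    (hpq : ENNReal.ofReal ρ ≤ hellingerAffinity volume (fun x => ENNReal.ofReal (p x))
      fun x => ENNReal.ofReal (q x)) {n : ℕ} {S : Set (Fin n → ℝ)} (hS : MeasurableSet S) :
    (ρ ^ n) ^ 2 ≤ ((sampleLaw n p).real S + (sampleLaw n q).real Sᶜ) *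
      (2 - ((sampleLaw n p).real S + (sampleLaw n q).real Sᶜ)) := by
  have hP := hp.isProbabilityMeasure_sampleLaw n
  have hQ := hq.isProbabilityMeasure_sampleLaw n
  have hpm := hp.1.ennreal_ofReal
  have hqm := hq.1.ennreal_ofReal
  rw [hp.sampleLaw_eq_withDensity] at hP ⊢
  rw [hq.sampleLaw_eq_withDensity] at hQ ⊢
  have affinity_le := hellingerAffinity_le_sqrt_test_errors (μ := (volume : Measure (Fin n → ℝ)))
    (f := fun X => ∏ i, ENNReal.ofReal (p (X i))) (g := fun X => ∏ i, ENNReal.ofReal (q (X i)))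
    (Finset.measurable_prod _ fun i _ => hpm.comp (measurable_pi_apply i)).aemeasurable
    (Finset.measurable_prod _ fun i _ => hqm.comp (measurable_pi_apply i)).aemeasurable hS
  rw [volume_pi, hellingerAffinity_pi (fun _ => volume) (fun _ => hpm) (fun _ => hqm),
    Finset.prod_const, Finset.card_univ, Fintype.card_fin] at affinity_le
  have pow_le := (pow_le_pow_left' hpq n).trans affinity_le
  rw [← ENNReal.ofReal_pow hρ, ENNReal.ofReal_le_ofReal_iff (Real.sqrt_nonneg _)] at pow_le
  have errors_le_two := add_le_add (measureReal_le_one (μ := volume.withDensity fun X : Fin n → ℝ =>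
    ∏ i, ENNReal.ofReal (p (X i))) (s := S)) (measureReal_le_one (μ := volume.withDensity
      fun X : Fin n → ℝ => ∏ i, ENNReal.ofReal (q (X i))) (s := Sᶜ))
  exact (Real.le_sqrt (by positivity)
    (mul_nonneg (by positivity) (by linarith))).1 pow_le

end SampleLaw

section Quantile

lemma measurable_score (f : ℝ → ℝ) : Measurable (score f) :=
  measurable_deriv _

namespace ScoreEstimator

variable {n : ℕ} (ψ : ScoreEstimator n)

lemma measurable_loss {f : ℝ → ℝ} (hf : Measurable f) : Measurable (ψ.loss f) := by
  have hψ : Measurable fun z : (Fin n → ℝ) × ℝ => ψ.1 (z.2, z.1) := ψ.2.comp measurable_swap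
  have integrand_measurable := (((hψ.sub ((measurable_score f).comp measurable_snd)).pow_const
    2).mul (hf.comp measurable_snd)).ennreal_ofReal
  exact integrand_measurable.lintegral_prod_right'

variable {ψ} {δ : ℝ} {f : ℝ → ℝ}

lemma le_lossQuantile {t : ℝ≥0}
    (ht : sampleLaw n f {X | ψ.loss f X ≤ t} < ENNReal.ofReal (1 - δ)) :
    (t : ℝ≥0∞) ≤ lossQuantile δ ψ f := by
  refine le_iInf₂ fun u hu => ?_
  by_contra! hut
  exact absurd (hu.trans (measure_mono fun X hX => hX.trans hut.le)) (not_le.2 ht)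

lemma sampleLaw_lt_of_lt_lossQuantile {t : ℝ≥0} (ht : t < lossQuantile δ ψ f) :
    sampleLaw n f {X | ψ.loss f X ≤ t} < ENNReal.ofReal (1 - δ) := by
  by_contra! h
  exact absurd (iInf₂_le t h) (not_le.2 ht)

lemma ofReal_mul_lossQuantile_le_lintegral_loss (hδ : 0 < δ) (hδ' : δ ≤ 1) (hf : IsDensity f) :
    ENNReal.ofReal δ * lossQuantile δ ψ f ≤ ∫⁻ X, ψ.loss f X ∂(sampleLaw n f) := by
  have := hf.isProbabilityMeasure_sampleLaw n
  have loss_measurable := ψ.measurable_loss hf.1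
  rw [mul_comm, ← ENNReal.le_div_iff_mul_le (by simp [hδ]) (by simp)]
  refine ENNReal.le_of_forall_nnreal_lt fun t ht => ?_
  rw [ENNReal.le_div_iff_mul_le (by simp [hδ]) (by simp)]
  refine le_trans ?_ (mul_meas_ge_le_lintegral loss_measurable t)
  gcongr
  calc
    ENNReal.ofReal δ = 1 - ENNReal.ofReal (1 - δ) := by
      rw [← ENNReal.ofReal_one, ← ENNReal.ofReal_sub _ (sub_nonneg.2 hδ'), sub_sub_cancel]
    _ ≤ 1 - sampleLaw n f {X | ψ.loss f X ≤ t} :=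
      tsub_le_tsub_left (sampleLaw_lt_of_lt_lossQuantile ht).le _
    _ = sampleLaw n f {X | ψ.loss f X ≤ t}ᶜ :=
      (prob_compl_eq_one_sub (measurableSet_le loss_measurable measurable_const)).symm
    _ ≤ sampleLaw n f {X | t ≤ ψ.loss f X} :=
      measure_mono fun X (hX : ¬ψ.loss f X ≤ t) => (not_le.1 hX).le

end ScoreEstimator

variable {n : ℕ} {δ : ℝ} {G : Set (ℝ → ℝ)}

lemma le_minimaxQuantile {t₀ : ℝ≥0∞}
    (h : ∀ ψ : ScoreEstimator n, ∀ t : ℝ≥0, (t : ℝ≥0∞) < t₀ →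
      ∃ f ∈ G, sampleLaw n f {X | ψ.loss f X ≤ t} < ENNReal.ofReal (1 - δ)) :
    t₀ ≤ minimaxQuantile n δ G :=
  le_iInf fun ψ => ENNReal.le_of_forall_nnreal_lt fun t ht =>
    have ⟨f, hfG, hf⟩ := h ψ t ht
    (ScoreEstimator.le_lossQuantile hf).trans
      (le_iSup₂ (f := fun f (_ : f ∈ G) => lossQuantile δ ψ f) f hfG)

lemma ofReal_mul_minimaxQuantile_le_minimaxRisk (hδ : 0 < δ) (hδ' : δ ≤ 1)
    (hG : ∀ f ∈ G, IsDensity f) :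
    ENNReal.ofReal δ * minimaxQuantile n δ G ≤ minimaxRisk n G := by
  refine le_iInf fun ψ => (mul_le_mul_right (iInf_le _ ψ) _).trans ?_
  simp only [ENNReal.mul_iSup]
  exact iSup₂_mono fun f hf =>
    ScoreEstimator.ofReal_mul_lossQuantile_le_lintegral_loss hδ hδ' (hG f hf)

end Quantile

section Assouad

variable {ι Ω : Type*} [Fintype ι] [MeasurableSpace Ω]

/-- Assouad's lemma: flipping one coordinate of the parameter is an involution, so the two errors of
each coordinate test can be averaged over the hypercube. -/
lemma exists_card_mul_le_sum_measureReal_ne [DecidableEq ι] (P : (ι → Bool) → Measure Ω)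
    (d : Ω → ι → Bool) {α : ℝ}
    (hα : ∀ θ j, α ≤ (P θ).real {ω | d ω j ≠ θ j} +
      (P (Function.update θ j (!θ j))).real {ω | d ω j ≠ θ j}ᶜ) :
    ∃ θ, Fintype.card ι * (α / 2) ≤ ∑ j, (P θ).real {ω | d ω j ≠ θ j} := by
  have coordinate_bound : ∀ j,
      ∑ _θ : ι → Bool, α / 2 ≤ ∑ θ, (P θ).real {ω | d ω j ≠ θ j} := fun j => by
    have flip_involutive :
        Function.Involutive fun θ : ι → Bool => Function.update θ j (!θ j) := fun θ => by simp
    have sum_flip := Equiv.sum_comp (flip_involutive.toPerm _)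
      fun θ => (P θ).real {ω | d ω j ≠ θ j}
    have sum_le := Finset.sum_le_sum fun θ (_ : θ ∈ Finset.univ) => hα θ j
    have compl_eq : ∀ θ : ι → Bool, {ω | d ω j ≠ θ j}ᶜ = {ω | d ω j ≠ !θ j} := fun θ => by
      ext ω; simp
    simp only [compl_eq, Finset.sum_add_distrib] at sum_le
    simp only [Function.Involutive.coe_toPerm, Function.update_self] at sum_flip
    rw [sum_flip] at sum_le
    rw [← Finset.sum_div]
    linarith
  have sum_le : ∑ _θ : ι → Bool, Fintype.card ι * (α / 2) ≤
      ∑ θ, ∑ j, (P θ).real {ω | d ω j ≠ θ j} := by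
    rw [Finset.sum_comm]
    refine le_trans (le_of_eq ?_) (Finset.sum_le_sum fun j _ => coordinate_bound j)
    simp only [Finset.sum_const, Finset.card_univ, nsmul_eq_mul]
    ring
  obtain ⟨θ, -, hθ⟩ := Finset.exists_le_of_sum_le Finset.univ_nonempty sum_le
  exact ⟨θ, hθ⟩

variable {μ : Measure Ω} {d : Ω → ι → Bool} (θ : ι → Bool)

lemma integrable_hammingDist [IsFiniteMeasure μ] (hd : Measurable d) :
    Integrable (fun ω => (hammingDist (d ω) θ : ℝ)) μ :=
  .of_bound ((measurable_of_countable fun η : ι → Bool =>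
    (hammingDist η θ : ℝ)).comp hd).aestronglyMeasurable (Fintype.card ι)
      (.of_forall fun ω => by simpa using hammingDist_le_card_fintype)

lemma integral_hammingDist [IsFiniteMeasure μ] (hd : Measurable d) :
    ∫ ω, (hammingDist (d ω) θ : ℝ) ∂μ = ∑ j, μ.real {ω | d ω j ≠ θ j} := by
  have error_measurable : ∀ j, MeasurableSet {ω | d ω j ≠ θ j} := fun j =>
    (measurable_pi_iff.1 hd j) (measurableSet_singleton (θ j)).compl
  have hammingDist_eq_sum : ∀ ω, (hammingDist (d ω) θ : ℝ) =
      ∑ j, {ω | d ω j ≠ θ j}.indicator (fun _ => (1 : ℝ)) ω := fun ω => by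
    simp [hammingDist, Set.indicator_apply, Finset.card_filter, ite_not]
  simp only [hammingDist_eq_sum]
  rw [integral_finsetSum _ fun j _ => (integrable_const 1).indicator (error_measurable j)]
  simp [integral_indicator_const _ (error_measurable _)]

lemma mul_measureReal_hammingDist_lt_le [IsProbabilityMeasure μ] (hd : Measurable d) (k : ℕ) :
    (Fintype.card ι + 1 - k) * μ.real {ω | hammingDist (d ω) θ < k} ≤
      Fintype.card ι - ∑ j, μ.real {ω | d ω j ≠ θ j} := by
  have event_eq : {ω | hammingDist (d ω) θ < k} =
      {ω | (Fintype.card ι + 1 - k : ℝ) ≤ Fintype.card ι - hammingDist (d ω) θ} := by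
    ext ω
    change hammingDist (d ω) θ + 1 ≤ k ↔ _ ≤ (_ : ℝ)
    rw [← Nat.cast_le (α := ℝ)]
    push_cast
    constructor <;> intro <;> linarith
  have integral_eq : ∫ ω, (Fintype.card ι - hammingDist (d ω) θ : ℝ) ∂μ =
      Fintype.card ι - ∑ j, μ.real {ω | d ω j ≠ θ j} := by
    rw [integral_sub (integrable_const _) (integrable_hammingDist θ hd),
      integral_hammingDist θ hd]
    simp
  rw [event_eq, ← integral_eq]
  exact mul_meas_ge_le_integral_of_nonneg
    (.of_forall fun ω => sub_nonneg.2 (by exact_mod_cast hammingDist_le_card_fintype))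
    ((integrable_const _).sub (integrable_hammingDist θ hd)) _

end Assouad

namespace ScoreEstimator

variable {n : ℕ} (ψ : ScoreEstimator n) {κ : ℝ}

/-- The loss of `ψ` restricted to `B`, for the score `g` and with the density replaced by a lower
bound `κ` for it. -/
noncomputable def localLoss (κ : ℝ) (B : Set ℝ) (g : ℝ → ℝ) (X : Fin n → ℝ) : ℝ≥0∞ :=
  ∫⁻ x in B, ENNReal.ofReal (κ * (ψ.1 (x, X) - g x) ^ 2)

lemma measurable_localLoss (B : Set ℝ) {g : ℝ → ℝ} (hg : Measurable g) :
    Measurable (ψ.localLoss κ B g) := by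
  have hψ : Measurable fun z : (Fin n → ℝ) × ℝ => ψ.1 (z.2, z.1) := ψ.2.comp measurable_swap
  have integrand_measurable :=
    (((hψ.sub (hg.comp measurable_snd)).pow_const 2).const_mul κ).ennreal_ofReal
  exact integrand_measurable.lintegral_prod_right'

lemma sum_localLoss_le_loss {ι : Type*} [Fintype ι] {B : ι → Set ℝ}
    (hB : ∀ j, MeasurableSet (B j)) (hBd : Pairwise (Function.onFun Disjoint B)) {f : ℝ → ℝ}
    {g : ι → ℝ → ℝ} (hκ : ∀ j, ∀ x ∈ B j, κ ≤ f x) (hg : ∀ j, ∀ x ∈ B j, score f x = g j x)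
    (X : Fin n → ℝ) :
    ∑ j, ψ.localLoss κ (B j) (g j) X ≤ ψ.loss f X := by
  have localLoss_le : ∀ j, ψ.localLoss κ (B j) (g j) X ≤
      ∫⁻ x in B j, ENNReal.ofReal ((ψ.1 (x, X) - score f x) ^ 2 * f x) := fun j =>
    setLIntegral_mono' (hB j) fun x hx => ENNReal.ofReal_le_ofReal <| by
      rw [hg j x hx, mul_comm]
      exact mul_le_mul_of_nonneg_left (hκ j x hx) (sq_nonneg _)
  refine (Finset.sum_le_sum fun j _ => localLoss_le j).trans ?_
  rw [← tsum_fintype (L := .unconditional ι), ← lintegral_iUnion hB hBd]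
  exact setLIntegral_le_lintegral _ _

lemma two_mul_lintegral_le_localLoss_add_localLoss (hκ : 0 ≤ κ) (B : Set ℝ) {g₁ g₂ : ℝ → ℝ}
    (hg₁ : Measurable g₁) (X : Fin n → ℝ) :
    2 * ∫⁻ x in B, ENNReal.ofReal (κ * ((g₁ x - g₂ x) / 2) ^ 2) ≤
      ψ.localLoss κ B g₁ X + ψ.localLoss κ B g₂ X := by
  have hψ : Measurable fun x => ψ.1 (x, X) := ψ.2.comp measurable_prodMk_right
  have integrand_measurable : Measurable fun x => ENNReal.ofReal (κ * (ψ.1 (x, X) - g₁ x) ^ 2) :=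
    (((hψ.sub hg₁).pow_const 2).const_mul κ).ennreal_ofReal
  rw [localLoss, localLoss, ← lintegral_add_left integrand_measurable,
    ← lintegral_const_mul' _ _ ENNReal.ofNat_ne_top]
  refine lintegral_mono fun x => ?_
  rw [← ENNReal.ofReal_add (by positivity) (by positivity), ← ENNReal.ofReal_ofNat 2,
    ← ENNReal.ofReal_mul (by norm_num)]
  refine ENNReal.ofReal_le_ofReal ?_
  nlinarith [mul_nonneg hκ (sq_nonneg (ψ.1 (x, X) - (g₁ x + g₂ x) / 2))]

open Classical in
/-- The minimum distance decoder: on each bin `B j`, the sign `b` whose score `g b` is the closer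
to the estimator `ψ` in `L²`. -/
noncomputable def decode {ι : Type*} (κ : ℝ) (B : ι → Set ℝ) (g : Bool → ℝ → ℝ)
    (X : Fin n → ℝ) (j : ι) : Bool :=
  decide (ψ.localLoss κ (B j) (g true) X ≤ ψ.localLoss κ (B j) (g false) X)

variable {ι : Type*} {B : ι → Set ℝ} {g : Bool → ℝ → ℝ}

lemma measurable_decode (hg : ∀ b, Measurable (g b)) : Measurable (ψ.decode κ B g) := by
  refine measurable_pi_iff.2 fun j => measurable_to_bool ?_
  have preimage_eq : (fun X => ψ.decode κ B g X j) ⁻¹' {true} =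
      {X | ψ.localLoss κ (B j) (g true) X ≤ ψ.localLoss κ (B j) (g false) X} := by
    ext X
    simp [decode]
  rw [preimage_eq]
  exact measurableSet_le (ψ.measurable_localLoss _ (hg _)) (ψ.measurable_localLoss _ (hg _))

lemma le_localLoss_of_decode_ne (hκ : 0 ≤ κ) (hg : ∀ b, Measurable (g b)) {τ : ℝ≥0∞} {j : ι}
    (hτ : τ ≤ ∫⁻ x in B j, ENNReal.ofReal (κ * ((g true x - g false x) / 2) ^ 2))
    {X : Fin n → ℝ} {b : Bool} (hb : ψ.decode κ B g X j ≠ b) :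
    τ ≤ ψ.localLoss κ (B j) (g b) X := by
  have two_mul_le : 2 * τ ≤ ψ.localLoss κ (B j) (g true) X + ψ.localLoss κ (B j) (g false) X :=
    (mul_le_mul_right hτ 2).trans
      (ψ.two_mul_lintegral_le_localLoss_add_localLoss hκ (B j) (hg true) X)
  by_contra! hlt
  rw [two_mul] at two_mul_le
  cases b
  · have htrue : ψ.localLoss κ (B j) (g true) X ≤ ψ.localLoss κ (B j) (g false) X := by
      simpa [decode] using hb
    exact absurd two_mul_le (not_le.2 (ENNReal.add_lt_add (htrue.trans_lt hlt) hlt))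
  · have hfalse : ψ.localLoss κ (B j) (g false) X < ψ.localLoss κ (B j) (g true) X := by
      simpa [decode] using hb
    exact absurd two_mul_le (not_le.2 (ENNReal.add_lt_add hlt (hfalse.trans hlt)))

variable [Fintype ι] {f : (ι → Bool) → ℝ → ℝ} {τ : ℝ≥0∞}

lemma mul_hammingDist_decode_le_loss (hκ : 0 ≤ κ) (hg : ∀ b, Measurable (g b))
    (hB : ∀ j, MeasurableSet (B j)) (hBd : Pairwise (Function.onFun Disjoint B))
    (hlow : ∀ θ j, ∀ x ∈ B j, κ ≤ f θ x)
    (hscore : ∀ θ j, ∀ x ∈ B j, score (f θ) x = g (θ j) x)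
    (hτ : ∀ j, τ ≤ ∫⁻ x in B j, ENNReal.ofReal (κ * ((g true x - g false x) / 2) ^ 2))
    (θ : ι → Bool) (X : Fin n → ℝ) :
    τ * hammingDist (ψ.decode κ B g X) θ ≤ ψ.loss (f θ) X := by
  refine le_trans ?_ (ψ.sum_localLoss_le_loss hB hBd (hlow θ) (hscore θ) X)
  rw [hammingDist, Finset.card_filter, Nat.cast_sum, Finset.mul_sum]
  refine Finset.sum_le_sum fun j _ => ?_
  split_ifs with h
  · simpa using ψ.le_localLoss_of_decode_ne hκ hg (hτ j) h
  · simp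

lemma exists_sampleLaw_loss_le [DecidableEq ι] (hf : ∀ θ, IsDensity (f θ)) (hκ : 0 ≤ κ)
    (hg : ∀ b, Measurable (g b)) (hB : ∀ j, MeasurableSet (B j))
    (hBd : Pairwise (Function.onFun Disjoint B)) (hlow : ∀ θ j, ∀ x ∈ B j, κ ≤ f θ x)
    (hscore : ∀ θ j, ∀ x ∈ B j, score (f θ) x = g (θ j) x)
    (hτ : ∀ j, τ ≤ ∫⁻ x in B j, ENNReal.ofReal (κ * ((g true x - g false x) / 2) ^ 2)) {α : ℝ}
    (hα : ∀ θ j (S : Set (Fin n → ℝ)), MeasurableSet S → α ≤ (sampleLaw n (f θ)).real S +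
      (sampleLaw n (f (Function.update θ j (!θ j)))).real Sᶜ)
    {k : ℕ} (hk : k ≤ Fintype.card ι) {t : ℝ≥0} (ht : (t : ℝ≥0∞) < τ * k) :
    ∃ θ, (Fintype.card ι + 1 - k) * (sampleLaw n (f θ)).real {X | ψ.loss (f θ) X ≤ t} ≤
      Fintype.card ι * (1 - α / 2) := by
  have decode_measurable := ψ.measurable_decode (κ := κ) (B := B) hg
  obtain ⟨θ, hθ⟩ := exists_card_mul_le_sum_measureReal_ne (fun θ => sampleLaw n (f θ))
    (ψ.decode κ B g) fun θ j => hα θ j _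
      ((measurable_pi_iff.1 decode_measurable j) (measurableSet_singleton (θ j)).compl)
  refine ⟨θ, ?_⟩
  have := (hf θ).isProbabilityMeasure_sampleLaw n
  have event_subset : {X | ψ.loss (f θ) X ≤ t} ⊆
      {X | hammingDist (ψ.decode κ B g X) θ < k} := fun X (hX : ψ.loss (f θ) X ≤ t) => by
    by_contra! hkX
    refine absurd ((mul_le_mul_right (Nat.cast_le.2 (not_lt.1 hkX)) τ).trans ?_) (not_le.2 ht)
    exact (ψ.mul_hammingDist_decode_le_loss hκ hg hB hBd hlow hscore hτ θ X).trans hX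
  have markov := mul_measureReal_hammingDist_lt_le (μ := sampleLaw n (f θ)) θ decode_measurable k
  have coefficient_nonneg : (0 : ℝ) ≤ Fintype.card ι + 1 - k := by
    linarith [Nat.cast_le (α := ℝ).2 hk]
  refine (mul_le_mul_of_nonneg_left (measureReal_mono event_subset) coefficient_nonneg).trans ?_
  linarith

end ScoreEstimator

section Bump

lemma hasDerivAt_max_zero_sq (x : ℝ) : HasDerivAt (fun y : ℝ => max y 0 ^ 2) (2 * max x 0) x := by
  rcases lt_trichotomy x 0 with hx | rfl | hx
  · rw [max_eq_right hx.le, mul_zero]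
    refine (hasDerivAt_const x (0 : ℝ)).congr_of_eventuallyEq ?_
    filter_upwards [gt_mem_nhds hx] with y hy
    simp [max_eq_right hy.le]
  · have isBigO_sq : (fun y : ℝ => max y 0 ^ 2) =O[nhds 0] fun y => ‖y - 0‖ ^ 2 := by
      refine .of_bound 1 (.of_forall fun y => ?_)
      rw [one_mul, sub_zero, norm_pow, norm_pow, norm_norm, Real.norm_eq_abs, Real.norm_eq_abs,
        abs_of_nonneg (le_max_right y 0)]
      gcongr
      exact max_le (le_abs_self y) (abs_nonneg y)
    simpa using (isBigO_sq.hasFDerivAt one_lt_two).hasDerivAt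
  · have hasDerivAt_sq : HasDerivAt (fun y : ℝ => y ^ 2) (2 * x) x := by
      simpa using hasDerivAt_pow 2 x
    rw [max_eq_left hx.le]
    refine hasDerivAt_sq.congr_of_eventuallyEq ?_
    filter_upwards [lt_mem_nhds hx] with y hy
    rw [max_eq_left hy.le]

/-- The positive part of the parabola `u (1 - u)`, from which `bump` is built. -/
noncomputable def parabolaCap (u : ℝ) : ℝ := max (u * (1 - u)) 0

/-- A continuously differentiable bump supported in `[0, 1]`, used to perturb the logarithm of a
density. It is odd about `1 / 2`, so that changing its sign does not change the total mass. -/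
noncomputable def bump (u : ℝ) : ℝ := parabolaCap u ^ 2 * (1 - 2 * u)

/-- The derivative of `bump`. -/
noncomputable def bumpDeriv (u : ℝ) : ℝ := 2 * parabolaCap u * (1 - 5 * parabolaCap u)

variable {u : ℝ}

lemma parabolaCap_eq_zero (hu : u ∉ Set.Ioo (0 : ℝ) 1) : parabolaCap u = 0 := by
  refine max_eq_right ?_
  rcases le_or_gt u 0 with h | h
  · nlinarith
  · nlinarith [not_lt.1 fun h1 => hu ⟨h, h1⟩]

lemma parabolaCap_of_mem (hu : u ∈ Set.Icc (0 : ℝ) 1) : parabolaCap u = u * (1 - u) :=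
  max_eq_left (mul_nonneg hu.1 (sub_nonneg.2 hu.2))

lemma parabolaCap_nonneg (u : ℝ) : 0 ≤ parabolaCap u :=
  le_max_right _ _

lemma parabolaCap_le (u : ℝ) : parabolaCap u ≤ 1 / 4 :=
  max_le (by nlinarith [sq_nonneg (u - 1 / 2)]) (by norm_num)

lemma parabolaCap_one_sub (u : ℝ) : parabolaCap (1 - u) = parabolaCap u := by
  rw [parabolaCap, sub_sub_cancel, mul_comm, parabolaCap]

lemma parabolaCap_projIcc (u : ℝ) :
    parabolaCap (Set.projIcc 0 1 zero_le_one u) = parabolaCap u := by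
  rcases le_total u 0 with h0 | h0
  · rw [Set.projIcc_of_le_left _ h0, parabolaCap_eq_zero (by simp),
      parabolaCap_eq_zero fun h => h.1.not_ge h0]
  rcases le_total 1 u with h1 | h1
  · rw [Set.projIcc_of_right_le _ h1, parabolaCap_eq_zero (by simp),
      parabolaCap_eq_zero fun h => h.2.not_ge h1]
  · rw [Set.projIcc_of_mem _ ⟨h0, h1⟩]

lemma abs_parabolaCap_sub_le (u v : ℝ) : |parabolaCap u - parabolaCap v| ≤ |u - v| := by
  rw [← parabolaCap_projIcc u, ← parabolaCap_projIcc v]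
  refine le_trans ?_ (Set.abs_projIcc_sub_projIcc (a := 0) (b := 1) zero_le_one)
  obtain ⟨c, hc0, hc1⟩ := Set.projIcc (0 : ℝ) 1 zero_le_one u
  obtain ⟨d, hd0, hd1⟩ := Set.projIcc (0 : ℝ) 1 zero_le_one v
  rw [parabolaCap_of_mem ⟨hc0, hc1⟩, parabolaCap_of_mem ⟨hd0, hd1⟩,
    show c * (1 - c) - d * (1 - d) = (c - d) * (1 - c - d) by ring, abs_mul]
  exact mul_le_of_le_one_right (abs_nonneg _) (abs_le.2 ⟨by linarith, by linarith⟩)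

lemma bump_eq_zero (hu : u ∉ Set.Ioo (0 : ℝ) 1) : bump u = 0 := by
  simp [bump, parabolaCap_eq_zero hu]

lemma bumpDeriv_eq_zero (hu : u ∉ Set.Ioo (0 : ℝ) 1) : bumpDeriv u = 0 := by
  simp [bumpDeriv, parabolaCap_eq_zero hu]

lemma bump_one_sub (u : ℝ) : bump (1 - u) = -bump u := by
  rw [bump, parabolaCap_one_sub, bump]
  ring

lemma continuous_parabolaCap : Continuous parabolaCap := by
  unfold parabolaCap
  fun_prop

lemma continuous_bump : Continuous bump := by
  have := continuous_parabolaCap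
  unfold bump
  fun_prop

lemma continuous_bumpDeriv : Continuous bumpDeriv := by
  have := continuous_parabolaCap
  unfold bumpDeriv
  fun_prop

lemma hasDerivAt_bump (u : ℝ) : HasDerivAt bump (bumpDeriv u) u := by
  have hasDerivAt_parabola : HasDerivAt (fun y : ℝ => y * (1 - y)) (1 * (1 - u) + u * (-1)) u :=
    (hasDerivAt_id u).mul ((hasDerivAt_id u).const_sub 1)
  have hasDerivAt_line : HasDerivAt (fun y : ℝ => 1 - 2 * y) (-(2 * 1)) u :=
    ((hasDerivAt_id u).const_mul 2).const_sub 1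
  refine (((hasDerivAt_max_zero_sq (u * (1 - u))).comp u hasDerivAt_parabola).mul
    hasDerivAt_line).congr_deriv ?_
  have cap_mul : parabolaCap u * (u * (1 - u) - parabolaCap u) = 0 := by
    by_cases hu : u ∈ Set.Ioo (0 : ℝ) 1
    · rw [parabolaCap_of_mem (Set.Ioo_subset_Icc_self hu), sub_self, mul_zero]
    · rw [parabolaCap_eq_zero hu, zero_mul]
  change 2 * parabolaCap u * (1 * (1 - u) + u * (-1)) * (1 - 2 * u) +
    parabolaCap u ^ 2 * -(2 * 1) = 2 * parabolaCap u * (1 - 5 * parabolaCap u)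
  linear_combination (-8) * cap_mul

lemma abs_bump_le (u : ℝ) : |bump u| ≤ 1 / 16 := by
  by_cases hu : u ∈ Set.Ioo (0 : ℝ) 1
  · have abs_line_le : |1 - 2 * u| ≤ 1 := abs_le.2 ⟨by linarith [hu.2], by linarith [hu.1]⟩
    calc
      |bump u| = parabolaCap u ^ 2 * |1 - 2 * u| := by
        rw [bump, abs_mul, abs_of_nonneg (sq_nonneg _)]
      _ ≤ (1 / 4) ^ 2 * 1 := by
        gcongr
        exacts [parabolaCap_nonneg u, parabolaCap_le u]
      _ = 1 / 16 := by norm_num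
  · rw [bump_eq_zero hu]
    norm_num

lemma abs_bumpDeriv_le (u : ℝ) : |bumpDeriv u| ≤ 1 / 8 := by
  have := parabolaCap_nonneg u
  have := parabolaCap_le u
  rw [bumpDeriv, abs_le]
  constructor <;> nlinarith [sq_nonneg (parabolaCap u - 1 / 10)]

lemma abs_bumpDeriv_sub_le (u v : ℝ) : |bumpDeriv u - bumpDeriv v| ≤ 3 * |u - v| := by
  have factor_le : |2 - 10 * (parabolaCap u + parabolaCap v)| ≤ 3 := by
    have := parabolaCap_nonneg u
    have := parabolaCap_nonneg v
    have := parabolaCap_le u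
    have := parabolaCap_le v
    exact abs_le.2 ⟨by linarith, by linarith⟩
  calc
    |bumpDeriv u - bumpDeriv v| =
        |2 - 10 * (parabolaCap u + parabolaCap v)| * |parabolaCap u - parabolaCap v| := by
      rw [← abs_mul, bumpDeriv, bumpDeriv]
      congr 1
      ring
    _ ≤ 3 * |u - v| :=
      mul_le_mul factor_le (abs_parabolaCap_sub_le u v) (abs_nonneg _) (by norm_num)

lemma integral_bumpDeriv_sq : ∫ u in (0 : ℝ)..1, bumpDeriv u ^ 2 = 2 / 315 := by
  have bumpDeriv_sq_eq : ∀ u ∈ Set.uIcc (0 : ℝ) 1, bumpDeriv u ^ 2 =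
      4 * u ^ 2 - 48 * u ^ 3 + 224 * u ^ 4 - 520 * u ^ 5 + 640 * u ^ 6 - 400 * u ^ 7
        + 100 * u ^ 8 := fun u hu => by
    rw [Set.uIcc_of_le zero_le_one] at hu
    rw [bumpDeriv, parabolaCap_of_mem hu]
    ring
  rw [intervalIntegral.integral_congr bumpDeriv_sq_eq]
  simp (disch := apply Continuous.intervalIntegrable; fun_prop) only [intervalIntegral.integral_add,
    intervalIntegral.integral_sub, intervalIntegral.integral_const_mul, integral_pow]
  norm_num

lemma lintegral_bumpDeriv_sq :
    ∫⁻ u in Set.Ioo (0 : ℝ) 1, ENNReal.ofReal (bumpDeriv u ^ 2) = ENNReal.ofReal (2 / 315) := by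
  have sq_integrableOn : IntegrableOn (fun u => bumpDeriv u ^ 2) (Set.Ioo 0 1) :=
    (continuous_bumpDeriv.pow 2).integrableOn_Icc.mono_set Set.Ioo_subset_Icc_self
  rw [← ofReal_integral_eq_lintegral_ofReal sq_integrableOn (.of_forall fun u => sq_nonneg _),
    ← integral_Ioc_eq_integral_Ioo, ← intervalIntegral.integral_of_le zero_le_one,
    integral_bumpDeriv_sq]

end Bump

section SignSum

/-- The sign `± 1` encoded by a Boolean. -/
def boolSign (b : Bool) : ℝ := bif b then 1 else -1

lemma abs_boolSign (b : Bool) : |boolSign b| = 1 := by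
  cases b <;> simp [boolSign]

/-- The sum of the translates of `φ` by `0, 1, …, m - 1` with the signs encoded by `θ`. -/
noncomputable def signSum {m : ℕ} (φ : ℝ → ℝ) (θ : Fin m → Bool) (u : ℝ) : ℝ :=
  ∑ j, boolSign (θ j) * φ (u - j)

variable {m : ℕ} {φ : ℝ → ℝ} {u : ℝ}

lemma eq_of_sub_mem_Ioo {i j : Fin m} (hi : u - (i : ℝ) ∈ Set.Ioo (0 : ℝ) 1)
    (hj : u - (j : ℝ) ∈ Set.Ioo (0 : ℝ) 1) : i = j := by
  have hij : (i : ℕ) < j + 1 := by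
    exact_mod_cast show (i : ℝ) < j + 1 by linarith [hi.1, hj.2]
  have hji : (j : ℕ) < i + 1 := by
    exact_mod_cast show (j : ℝ) < i + 1 by linarith [hi.2, hj.1]
  exact Fin.ext (by omega)

lemma signSum_of_sub_mem (hφ : ∀ u ∉ Set.Ioo (0 : ℝ) 1, φ u = 0) (θ : Fin m → Bool) {j : Fin m}
    (hu : u - (j : ℝ) ∈ Set.Ioo (0 : ℝ) 1) : signSum φ θ u = boolSign (θ j) * φ (u - j) := by
  refine Finset.sum_eq_single j (fun i _ hij => ?_) (by simp)
  rw [hφ _ fun hi => hij (eq_of_sub_mem_Ioo hi hu), mul_zero]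

lemma signSum_eq_zero (hφ : ∀ u ∉ Set.Ioo (0 : ℝ) 1, φ u = 0) (θ : Fin m → Bool)
    (hu : ∀ j : Fin m, u - (j : ℝ) ∉ Set.Ioo (0 : ℝ) 1) : signSum φ θ u = 0 :=
  Finset.sum_eq_zero fun j _ => by rw [hφ _ (hu j), mul_zero]

lemma abs_signSum_le (hφ : ∀ u ∉ Set.Ioo (0 : ℝ) 1, φ u = 0) {C : ℝ} (hC : ∀ u, |φ u| ≤ C)
    (θ : Fin m → Bool) (u : ℝ) : |signSum φ θ u| ≤ C := by
  by_cases h : ∃ j : Fin m, u - (j : ℝ) ∈ Set.Ioo (0 : ℝ) 1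
  · obtain ⟨j, hj⟩ := h
    rw [signSum_of_sub_mem hφ θ hj, abs_mul, abs_boolSign, one_mul]
    exact hC _
  · rw [signSum_eq_zero hφ θ (not_exists.1 h), abs_zero]
    exact (abs_nonneg _).trans (hC 0)

lemma card_filter_sub_mem_Ioo_le_one (u : ℝ) [DecidablePred fun j : Fin m =>
    u - (j : ℝ) ∈ Set.Ioo (0 : ℝ) 1] :
    (Finset.univ.filter fun j : Fin m => u - (j : ℝ) ∈ Set.Ioo (0 : ℝ) 1).card ≤ 1 :=
  Finset.card_le_one.2 fun _ hi _ hj =>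
    eq_of_sub_mem_Ioo (Finset.mem_filter.1 hi).2 (Finset.mem_filter.1 hj).2

/-- Only the bins of `u` and of `v` contribute to the difference, whence the factor `2`. -/
lemma abs_signSum_sub_le (hφ : ∀ u ∉ Set.Ioo (0 : ℝ) 1, φ u = 0) {K : ℝ}
    (hK : ∀ u v, |φ u - φ v| ≤ K * |u - v|) (θ : Fin m → Bool) (u v : ℝ) :
    |signSum φ θ u - signSum φ θ v| ≤ 2 * K * |u - v| := by
  classical
  set s := (Finset.univ.filter fun j : Fin m => u - (j : ℝ) ∈ Set.Ioo (0 : ℝ) 1) ∪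
    Finset.univ.filter fun j : Fin m => v - (j : ℝ) ∈ Set.Ioo (0 : ℝ) 1 with hs
  have card_le : s.card ≤ 2 := (Finset.card_union_le _ _).trans
    (add_le_add (card_filter_sub_mem_Ioo_le_one u) (card_filter_sub_mem_Ioo_le_one v))
  have sub_eq_sum : signSum φ θ u - signSum φ θ v =
      ∑ j ∈ s, boolSign (θ j) * (φ (u - j) - φ (v - j)) := by
    simp only [signSum, ← Finset.sum_sub_distrib, ← mul_sub]
    refine (Finset.sum_subset (Finset.subset_univ s) fun j _ hj => ?_).symm
    simp only [hs, Finset.mem_union, Finset.mem_filter, Finset.mem_univ, true_and, not_or] at hj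
    rw [hφ _ hj.1, hφ _ hj.2, sub_zero, mul_zero]
  have term_le : ∀ j ∈ s, |boolSign (θ j) * (φ (u - j) - φ (v - j))| ≤ K * |u - v| := fun j _ => by
    rw [abs_mul, abs_boolSign, one_mul]
    simpa using hK (u - j) (v - j)
  calc
    _ ≤ ∑ j ∈ s, |boolSign (θ j) * (φ (u - j) - φ (v - j))| := by
      rw [sub_eq_sum]
      exact Finset.abs_sum_le_sum_abs _ _
    _ ≤ s.card • (K * |u - v|) := Finset.sum_le_card_nsmul _ _ _ term_le
    _ ≤ 2 • (K * |u - v|) := nsmul_le_nsmul_left ((abs_nonneg _).trans (hK u v)) card_le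
    _ = 2 * K * |u - v| := by ring

lemma continuous_signSum (hφ : Continuous φ) (θ : Fin m → Bool) : Continuous (signSum φ θ) := by
  unfold signSum
  fun_prop

lemma hasDerivAt_signSum {φ' : ℝ → ℝ} (hφ : ∀ u, HasDerivAt φ (φ' u) u) (θ : Fin m → Bool)
    (u : ℝ) : HasDerivAt (signSum φ θ) (signSum φ' θ u) u :=
  .fun_sum fun j _ => ((hφ (u - j)).comp_sub_const u (j : ℝ)).const_mul _

end SignSum

section Plateau

/-- The signed distance from `x` to the interval `[0, ℓ]`: negative on its left, positive on its
right. -/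
noncomputable def overhang (ℓ x : ℝ) : ℝ := max (x - ℓ) 0 - max (-x) 0

/-- The unnormalised density equal to `1` on `[0, ℓ]`, with Cauchy tails of scale `1 / a`. -/
noncomputable def plateau (a ℓ x : ℝ) : ℝ := (1 + a ^ 2 * overhang ℓ x ^ 2)⁻¹

/-- The score of `plateau a ℓ`, as a function of the signed distance to `[0, ℓ]`. -/
noncomputable def plateauScore (a t : ℝ) : ℝ := -(2 * a ^ 2 * t / (1 + a ^ 2 * t ^ 2))

variable {a ℓ x : ℝ}

lemma overhang_eq_zero (hx : x ∈ Set.Icc 0 ℓ) : overhang ℓ x = 0 := by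
  rw [overhang, max_eq_right (by linarith [hx.2]), max_eq_right (by linarith [hx.1]), sub_zero]

lemma overhang_sq (hℓ : 0 ≤ ℓ) (x : ℝ) :
    overhang ℓ x ^ 2 = max (x - ℓ) 0 ^ 2 + max (-x) 0 ^ 2 := by
  rcases le_total 0 x with hx | hx
  · simp [overhang, max_eq_right (by linarith : -x ≤ 0)]
  · simp [overhang, max_eq_right (by linarith : x - ℓ ≤ 0)]

lemma continuous_overhang (ℓ : ℝ) : Continuous (overhang ℓ) := by
  unfold overhang
  fun_prop

lemma abs_overhang_sub_le (hℓ : 0 ≤ ℓ) (x y : ℝ) :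
    |overhang ℓ x - overhang ℓ y| ≤ |x - y| := by
  unfold overhang
  grind

lemma hasDerivAt_overhang_sq (hℓ : 0 ≤ ℓ) (x : ℝ) :
    HasDerivAt (fun y => overhang ℓ y ^ 2) (2 * overhang ℓ x) x := by
  simp only [overhang_sq hℓ]
  have right : HasDerivAt (fun y : ℝ => max (y - ℓ) 0 ^ 2) (2 * max (x - ℓ) 0) x :=
    (hasDerivAt_max_zero_sq (x - ℓ)).comp_sub_const x ℓ
  have left : HasDerivAt (fun y : ℝ => max (-y) 0 ^ 2) (2 * max (-x) 0 * (-1)) x :=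
    (hasDerivAt_max_zero_sq (-x)).comp x (hasDerivAt_neg x)
  refine (right.add left).congr_deriv ?_
  rw [overhang]
  ring

lemma plateau_pos (a ℓ x : ℝ) : 0 < plateau a ℓ x := by
  unfold plateau
  positivity

lemma plateau_le_one (a ℓ x : ℝ) : plateau a ℓ x ≤ 1 :=
  inv_le_one_of_one_le₀ (le_add_of_nonneg_right (by positivity))

lemma plateau_eq_one (a : ℝ) (hx : x ∈ Set.Icc 0 ℓ) : plateau a ℓ x = 1 := by
  simp [plateau, overhang_eq_zero hx]

lemma continuous_plateau (a ℓ : ℝ) : Continuous (plateau a ℓ) := by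
  have := continuous_overhang ℓ
  exact Continuous.inv₀ (by fun_prop) fun x => by positivity

lemma hasDerivAt_log_plateau (a : ℝ) (hℓ : 0 ≤ ℓ) (x : ℝ) :
    HasDerivAt (fun y => Real.log (plateau a ℓ y)) (plateauScore a (overhang ℓ x)) x := by
  simp only [plateau, Real.log_inv]
  have h0 : 1 + a ^ 2 * overhang ℓ x ^ 2 ≠ 0 := by positivity
  have h := ((((hasDerivAt_overhang_sq hℓ x).const_mul (a ^ 2)).const_add 1).log h0).neg
  refine h.congr_deriv ?_
  rw [plateauScore]
  ring

lemma abs_plateauScore_le (ha : 0 ≤ a) (t : ℝ) : |plateauScore a t| ≤ a := by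
  have h : 0 < 1 + a ^ 2 * t ^ 2 := by positivity
  rw [plateauScore, abs_neg, abs_div, abs_of_pos h, div_le_iff₀ h, abs_le]
  constructor <;> nlinarith [mul_nonneg ha (sq_nonneg (a * t - 1)),
    mul_nonneg ha (sq_nonneg (a * t + 1))]

lemma abs_plateauScore_sub_le (a s t : ℝ) :
    |plateauScore a s - plateauScore a t| ≤ 2 * a ^ 2 * |s - t| := by
  have hs : 0 < 1 + a ^ 2 * s ^ 2 := by positivity
  have ht : 0 < 1 + a ^ 2 * t ^ 2 := by positivity
  have factored : plateauScore a s - plateauScore a t = 2 * a ^ 2 * (s - t) *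
      ((a ^ 2 * s * t - 1) / ((1 + a ^ 2 * s ^ 2) * (1 + a ^ 2 * t ^ 2))) := by
    unfold plateauScore
    field_simp
    ring
  have quotient_le : |(a ^ 2 * s * t - 1) / ((1 + a ^ 2 * s ^ 2) * (1 + a ^ 2 * t ^ 2))| ≤ 1 := by
    rw [abs_div, abs_of_pos (mul_pos hs ht), div_le_one (mul_pos hs ht), abs_le]
    have : 0 ≤ (a * s) ^ 2 * (a * t) ^ 2 := by positivity
    constructor <;> nlinarith [sq_nonneg (a * s - a * t), sq_nonneg (a * s + a * t)]
  rw [factored, abs_mul, abs_mul, abs_of_nonneg (by positivity : 0 ≤ 2 * a ^ 2)]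
  exact mul_le_of_le_one_right (by positivity) quotient_le

lemma lintegral_inv_one_add_mul_sq (ha : 0 < a) (c : ℝ) :
    ∫⁻ x, ENNReal.ofReal (1 + (a * (x - c)) ^ 2)⁻¹ = ENNReal.ofReal (Real.pi / a) := by
  have integrable : Integrable fun x : ℝ => (1 + (a * (x - c)) ^ 2)⁻¹ :=
    (integrable_inv_one_add_sq.comp_mul_left' ha.ne').comp_sub_right c
  rw [← ofReal_integral_eq_lintegral_ofReal integrable (.of_forall fun x => by positivity),
    integral_sub_right_eq_self (fun x : ℝ => (1 + (a * x) ^ 2)⁻¹) c,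
    Measure.integral_comp_mul_left (fun x : ℝ => (1 + x ^ 2)⁻¹) a, integral_univ_inv_one_add_sq,
    abs_of_pos (inv_pos.2 ha), smul_eq_mul, div_eq_inv_mul]

lemma le_lintegral_plateau (ha : 0 < a) (hℓ : 0 ≤ ℓ) :
    ENNReal.ofReal (Real.pi / a) ≤ ∫⁻ x, ENNReal.ofReal (plateau a ℓ x) := by
  rw [← lintegral_inv_one_add_mul_sq ha 0]
  refine lintegral_mono fun x => ENNReal.ofReal_le_ofReal ?_
  have dist_le : |overhang ℓ x| ≤ |x - 0| := by
    simpa [overhang_eq_zero (⟨le_rfl, hℓ⟩ : (0 : ℝ) ∈ Set.Icc 0 ℓ)] using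
      abs_overhang_sub_le hℓ x 0
  have := sq_le_sq.2 dist_le
  rw [plateau, mul_pow]
  gcongr

lemma lintegral_plateau_le (ha : 0 < a) (hℓ : 0 ≤ ℓ) :
    ∫⁻ x, ENNReal.ofReal (plateau a ℓ x) ≤ ENNReal.ofReal (ℓ + 2 * (Real.pi / a)) := by
  have plateau_le : ∀ x, ENNReal.ofReal (plateau a ℓ x) ≤ (Set.Icc 0 ℓ).indicator 1 x +
      (ENNReal.ofReal (1 + (a * (x - 0)) ^ 2)⁻¹ + ENNReal.ofReal (1 + (a * (x - ℓ)) ^ 2)⁻¹) := by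
    intro x
    by_cases hx : x ∈ Set.Icc 0 ℓ
    · rw [Set.indicator_of_mem hx, plateau_eq_one a hx, ENNReal.ofReal_one]
      exact le_self_add
    rw [Set.indicator_of_notMem hx, zero_add, plateau, overhang, ← mul_pow]
    rw [Set.mem_Icc, not_and_or, not_le, not_le] at hx
    rcases hx with hx | hx
    · rw [max_eq_right (by linarith), max_eq_left (by linarith), zero_sub, neg_neg, sub_zero]
      exact le_self_add
    · rw [max_eq_left (by linarith), max_eq_right (by linarith), sub_zero (x - ℓ)]
      exact le_add_self
  refine (lintegral_mono plateau_le).trans_eq ?_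
  rw [lintegral_add_left (measurable_one.indicator measurableSet_Icc),
    lintegral_indicator_one measurableSet_Icc, Real.volume_Icc, sub_zero,
    lintegral_add_left (by fun_prop), lintegral_inv_one_add_mul_sq ha,
    lintegral_inv_one_add_mul_sq ha, ENNReal.ofReal_add hℓ (by positivity), two_mul,
    ENNReal.ofReal_add (by positivity) (by positivity)]

end Plateau

section Bins

/-- The `j`th of the consecutive open intervals of length `w` that start at the origin. -/
def bin (w : ℝ) (j : ℕ) : Set ℝ := Set.Ioo (j * w) ((j + 1) * w)

variable {w x : ℝ} {m : ℕ} {φ : ℝ → ℝ}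

lemma mem_bin_iff (hw : 0 < w) {j : ℕ} : x ∈ bin w j ↔ x / w - j ∈ Set.Ioo (0 : ℝ) 1 := by
  rw [bin, Set.mem_Ioo, Set.mem_Ioo, sub_pos, sub_lt_iff_lt_add', lt_div_iff₀ hw, div_lt_iff₀ hw]

lemma measurableSet_bin (w : ℝ) (j : ℕ) : MeasurableSet (bin w j) := measurableSet_Ioo

lemma volume_bin (w : ℝ) (j : ℕ) : volume (bin w j) = ENNReal.ofReal w := by
  rw [bin, Real.volume_Ioo]
  ring_nf

lemma bin_subset_Icc (hw : 0 ≤ w) (j : Fin m) : bin w j ⊆ Set.Icc 0 (m * w) := by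
  intro x hx
  have left : (0 : ℝ) ≤ (j : ℕ) * w := by positivity
  have right : ((j : ℕ) + 1 : ℝ) * w ≤ m * w := by
    gcongr
    exact_mod_cast j.2
  exact ⟨left.trans hx.1.le, hx.2.le.trans right⟩

lemma pairwise_disjoint_bin (hw : 0 < w) (m : ℕ) :
    Pairwise (Function.onFun Disjoint fun j : Fin m => bin w j) := fun _ _ hij =>
  Set.disjoint_left.2 fun _ hi hj =>
    hij (eq_of_sub_mem_Ioo ((mem_bin_iff hw).1 hi) ((mem_bin_iff hw).1 hj))

lemma volume_iUnion_bin (hw : 0 < w) (m : ℕ) :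
    volume (⋃ j : Fin m, bin w j) = ENNReal.ofReal (m * w) := by
  rw [measure_iUnion (pairwise_disjoint_bin hw m) fun j => measurableSet_bin w j]
  simp only [volume_bin, tsum_fintype, Finset.sum_const, Finset.card_univ, Fintype.card_fin,
    nsmul_eq_mul]
  rw [ENNReal.ofReal_mul (by positivity), ENNReal.ofReal_natCast]

lemma signSum_div_of_mem_bin (hw : 0 < w) (hφ : ∀ u ∉ Set.Ioo (0 : ℝ) 1, φ u = 0)
    (θ : Fin m → Bool) {j : Fin m} (hx : x ∈ bin w j) :
    signSum φ θ (x / w) = boolSign (θ j) * φ (x / w - (j : ℕ)) :=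
  signSum_of_sub_mem hφ θ ((mem_bin_iff hw).1 hx)

lemma signSum_div_eq_zero (hw : 0 < w) (hφ : ∀ u ∉ Set.Ioo (0 : ℝ) 1, φ u = 0)
    (θ : Fin m → Bool) (hx : x ∉ ⋃ j : Fin m, bin w j) : signSum φ θ (x / w) = 0 :=
  signSum_eq_zero hφ θ fun j hj => hx (Set.mem_iUnion.2 ⟨j, (mem_bin_iff hw).2 hj⟩)

lemma setLIntegral_bin_comp (hw : 0 < w) (j : ℕ) (F : ℝ → ℝ≥0∞) :
    ∫⁻ x in bin w j, F (x / w - j) = ENNReal.ofReal w * ∫⁻ u in Set.Ioo (0 : ℝ) 1, F u := by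
  have hw' : w⁻¹ ≠ 0 := inv_ne_zero hw.ne'
  have indicator_comp : ∀ x, (bin w j).indicator (fun x => F (x / w - j)) x =
      (Set.Ioo (0 : ℝ) 1).indicator F (w⁻¹ * x - j) := by
    intro x
    rw [inv_mul_eq_div]
    by_cases hx : x ∈ bin w j
    · rw [Set.indicator_of_mem hx, Set.indicator_of_mem ((mem_bin_iff hw).1 hx)]
    · rw [Set.indicator_of_notMem hx, Set.indicator_of_notMem (mt (mem_bin_iff hw).2 hx)]
  rw [← lintegral_indicator (measurableSet_bin w j), ← lintegral_indicator measurableSet_Ioo,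
    lintegral_congr indicator_comp, ← (measurableEmbedding_mulLeft₀ hw').lintegral_map
    fun y => (Set.Ioo (0 : ℝ) 1).indicator F (y - j), Real.map_volume_mul_left hw',
    lintegral_smul_measure, inv_inv, abs_of_pos hw,
    lintegral_sub_right_eq_self (fun y => (Set.Ioo (0 : ℝ) 1).indicator F y) (j : ℝ), smul_eq_mul]

lemma lintegral_comp_neg_bump (G : ℝ → ℝ≥0∞) :
    ∫⁻ u in Set.Ioo (0 : ℝ) 1, G (-bump u) = ∫⁻ u in Set.Ioo (0 : ℝ) 1, G (bump u) := by
  rw [← lintegral_indicator measurableSet_Ioo, ← lintegral_indicator measurableSet_Ioo,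
    ← lintegral_sub_left_eq_self _ (1 : ℝ)]
  refine lintegral_congr fun u => ?_
  have mem_iff : 1 - u ∈ Set.Ioo (0 : ℝ) 1 ↔ u ∈ Set.Ioo (0 : ℝ) 1 := by
    simp only [Set.mem_Ioo, sub_pos, sub_lt_self_iff]
    exact and_comm
  by_cases hu : u ∈ Set.Ioo (0 : ℝ) 1
  · rw [Set.indicator_of_mem hu, Set.indicator_of_mem (mem_iff.2 hu), bump_one_sub, neg_neg]
  · rw [Set.indicator_of_notMem hu, Set.indicator_of_notMem (mt mem_iff.1 hu)]

end Bins

section Holder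

lemma le_mul_rpow_of_le_of_le_mul {C d D γ : ℝ} (hC : 0 ≤ C) (hd : 0 ≤ d) (hγ : 0 ≤ γ)
    (hγ' : γ ≤ 1) (h : D ≤ C) (h' : D ≤ C * d) : D ≤ C * d ^ γ := by
  rcases le_total d 1 with hd' | hd'
  · refine h'.trans (mul_le_mul_of_nonneg_left ?_ hC)
    simpa using Real.rpow_le_rpow_of_exponent_ge' hd hd' hγ hγ'
  · exact h.trans (le_mul_of_one_le_right hC (Real.one_le_rpow hd' hγ))

lemma abs_plateauScore_sub_le_rpow {a β : ℝ} (ha : 0 < a) (hβ : 1 ≤ β) (hβ' : β ≤ 2) (s t : ℝ) :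
    |plateauScore a s - plateauScore a t| ≤ 2 * a ^ β * |s - t| ^ (β - 1) := by
  have bounded : |plateauScore a s - plateauScore a t| ≤ 2 * a := by
    linarith [abs_sub (plateauScore a s) (plateauScore a t), abs_plateauScore_le ha.le s,
      abs_plateauScore_le ha.le t]
  have lipschitz : |plateauScore a s - plateauScore a t| ≤ 2 * a * (a * |s - t|) :=
    (abs_plateauScore_sub_le a s t).trans_eq (by ring)
  refine (le_mul_rpow_of_le_of_le_mul (by positivity) (by positivity) (by linarith)
    (by linarith : β - 1 ≤ 1) bounded lipschitz).trans_eq ?_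
  rw [Real.mul_rpow ha.le (abs_nonneg _), Real.rpow_sub_one ha.ne']
  field_simp

lemma abs_signSum_bumpDeriv_sub_le_rpow {m : ℕ} {γ : ℝ} (hγ : 0 ≤ γ) (hγ' : γ ≤ 1)
    (θ : Fin m → Bool) (u v : ℝ) :
    |signSum bumpDeriv θ u - signSum bumpDeriv θ v| ≤ 6 * |u - v| ^ γ := by
  have bound (u : ℝ) : |signSum bumpDeriv θ u| ≤ 1 / 8 :=
    abs_signSum_le (fun _ => bumpDeriv_eq_zero) abs_bumpDeriv_le θ u
  refine le_mul_rpow_of_le_of_le_mul (by norm_num) (abs_nonneg _) hγ hγ' ?_ ?_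
  · linarith [abs_sub (signSum bumpDeriv θ u) (signSum bumpDeriv θ v), bound u, bound v]
  · exact (abs_signSum_sub_le (fun _ => bumpDeriv_eq_zero) abs_bumpDeriv_sub_le θ u v).trans_eq
      (by ring)

end Holder

/-- The parameters of a hypercube of densities: `m` bins of length `width` carry bumps of size
`height`, and the Cauchy tails outside them have scale `1 / decay`. The last condition keeps a fixed
proportion of the mass in the tails, so that all normalising constants are of order `1 / decay`. -/
structure TiltParams (m : ℕ) where
  decay : ℝ
  width : ℝ
  height : ℝ
  decay_pos : 0 < decay
  width_pos : 0 < width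
  height_pos : 0 < height
  height_le_one : height ≤ 1
  decay_mul_le : decay * (m * width) ≤ 1 / 4

namespace TiltParams

variable {m : ℕ} (T : TiltParams m) (θ : Fin m → Bool)

/-- The plateau over the bins, tilted by a bump of sign `θ j` on the `j`th bin. -/
noncomputable def unnormalized (x : ℝ) : ℝ :=
  plateau T.decay (m * T.width) x * Real.exp (T.height * signSum bump θ (x / T.width))

/-- The normalising constant of the tilted plateaus. It is computed with positive signs; as the
bumps are odd about the centre of their bins, all signs give the same value. -/
noncomputable def mass : ℝ :=
  (∫⁻ x, ENNReal.ofReal (T.unnormalized (fun _ => true) x)).toReal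

/-- The probability density proportional to `T.unnormalized θ`. -/
noncomputable def density (x : ℝ) : ℝ := T.unnormalized θ x / T.mass

lemma span_nonneg : 0 ≤ m * T.width := mul_nonneg m.cast_nonneg T.width_pos.le

lemma slope_pos : 0 < T.height / T.width := div_pos T.height_pos T.width_pos

section Mass

lemma abs_mul_signSum_bump_le (u : ℝ) : |T.height * signSum bump θ u| ≤ T.height / 16 := by
  rw [abs_mul, abs_of_pos T.height_pos, div_eq_mul_one_div]
  exact mul_le_mul_of_nonneg_left (abs_signSum_le (fun _ => bump_eq_zero) abs_bump_le θ u)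
    T.height_pos.le

lemma half_le_exp (u : ℝ) : 1 / 2 ≤ Real.exp (T.height * signSum bump θ u) := by
  linarith [(abs_le.1 (T.abs_mul_signSum_bump_le θ u)).1, T.height_le_one,
    Real.add_one_le_exp (T.height * signSum bump θ u)]

lemma exp_le_two (u : ℝ) : Real.exp (T.height * signSum bump θ u) ≤ 2 := by
  have le_half : T.height * signSum bump θ u ≤ 1 / 2 := by
    linarith [(abs_le.1 (T.abs_mul_signSum_bump_le θ u)).2, T.height_le_one]
  rw [← inv_inv (Real.exp _), ← Real.exp_neg]
  refine inv_le_of_inv_le₀ two_pos ?_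
  linarith [Real.add_one_le_exp (-(T.height * signSum bump θ u))]

lemma unnormalized_pos (x : ℝ) : 0 < T.unnormalized θ x :=
  mul_pos (plateau_pos _ _ _) (Real.exp_pos _)

lemma continuous_unnormalized : Continuous (T.unnormalized θ) := by
  have := continuous_plateau T.decay (m * T.width)
  have := continuous_signSum continuous_bump θ
  unfold unnormalized
  fun_prop

lemma setLIntegral_bin_unnormalized (j : Fin m) :
    ∫⁻ x in bin T.width j, ENNReal.ofReal (T.unnormalized θ x) = ENNReal.ofReal T.width *
      ∫⁻ u in Set.Ioo (0 : ℝ) 1, ENNReal.ofReal (Real.exp (T.height * bump u)) := by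
  set F : ℝ → ℝ≥0∞ := fun v => ENNReal.ofReal (Real.exp (T.height * v))
  have unnormalized_eq : ∀ x ∈ bin T.width j, ENNReal.ofReal (T.unnormalized θ x) =
      F (boolSign (θ j) * bump (x / T.width - (j : ℕ))) := fun x hx => by
    rw [unnormalized, plateau_eq_one _ (bin_subset_Icc T.width_pos.le j hx),
      signSum_div_of_mem_bin T.width_pos (fun _ => bump_eq_zero) θ hx, one_mul]
  rw [setLIntegral_congr_fun (measurableSet_bin T.width j) unnormalized_eq,
    setLIntegral_bin_comp T.width_pos j fun u => F (boolSign (θ j) * bump u)]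
  congr 1
  cases θ j
  · simpa only [boolSign, cond_false, neg_one_mul] using lintegral_comp_neg_bump F
  · simp only [boolSign, cond_true, one_mul, F]

lemma lintegral_unnormalized_eq (θ θ' : Fin m → Bool) :
    ∫⁻ x, ENNReal.ofReal (T.unnormalized θ x) = ∫⁻ x, ENNReal.ofReal (T.unnormalized θ' x) := by
  have measurable_union : MeasurableSet (⋃ j : Fin m, bin T.width j) :=
    .iUnion fun j => measurableSet_bin T.width j
  rw [← lintegral_add_compl (fun x => ENNReal.ofReal (T.unnormalized θ x)) measurable_union,
    ← lintegral_add_compl (fun x => ENNReal.ofReal (T.unnormalized θ' x)) measurable_union]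
  congr 1
  · simp only [lintegral_iUnion (fun j : Fin m => measurableSet_bin T.width j)
      (pairwise_disjoint_bin T.width_pos m), setLIntegral_bin_unnormalized]
  · refine setLIntegral_congr_fun measurable_union.compl fun x hx => ?_
    simp only [unnormalized, signSum_div_eq_zero T.width_pos (fun _ => bump_eq_zero) _ hx]

lemma le_lintegral_unnormalized :
    ENNReal.ofReal (1 / T.decay) ≤ ∫⁻ x, ENNReal.ofReal (T.unnormalized θ x) := by
  have ha := T.decay_pos
  have hpi := Real.pi_gt_three
  calc
    _ ≤ ENNReal.ofReal (1 / 2) * ENNReal.ofReal (Real.pi / T.decay) := by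
      rw [← ENNReal.ofReal_mul (by norm_num), ← mul_div_assoc]
      gcongr
      linarith
    _ ≤ ENNReal.ofReal (1 / 2) * ∫⁻ x, ENNReal.ofReal (plateau T.decay (m * T.width) x) := by
      gcongr
      exact le_lintegral_plateau ha T.span_nonneg
    _ ≤ _ := by
      rw [← lintegral_const_mul' _ _ ENNReal.ofReal_ne_top]
      refine lintegral_mono fun x => ?_
      rw [← ENNReal.ofReal_mul (by norm_num), mul_comm]
      exact ENNReal.ofReal_le_ofReal
        (mul_le_mul_of_nonneg_left (T.half_le_exp θ _) (plateau_pos _ _ _).le)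

lemma lintegral_unnormalized_le :
    ∫⁻ x, ENNReal.ofReal (T.unnormalized θ x) ≤ ENNReal.ofReal (16 / T.decay) := by
  have ha := T.decay_pos
  calc
    _ ≤ ∫⁻ x, ENNReal.ofReal 2 * ENNReal.ofReal (plateau T.decay (m * T.width) x) := by
      refine lintegral_mono fun x => ?_
      rw [← ENNReal.ofReal_mul zero_le_two, mul_comm 2]
      exact ENNReal.ofReal_le_ofReal
        (mul_le_mul_of_nonneg_left (T.exp_le_two θ _) (plateau_pos _ _ _).le)
    _ ≤ ENNReal.ofReal 2 * ENNReal.ofReal (m * T.width + 2 * (Real.pi / T.decay)) := by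
      rw [lintegral_const_mul' _ _ ENNReal.ofReal_ne_top]
      gcongr
      exact lintegral_plateau_le ha T.span_nonneg
    _ ≤ _ := by
      rw [← ENNReal.ofReal_mul zero_le_two]
      refine ENNReal.ofReal_le_ofReal ((le_div_iff₀ ha).2 ?_)
      calc
        _ = 2 * (T.decay * (m * T.width)) + 4 * Real.pi := by
          field_simp
          ring
        _ ≤ 16 := by linarith [T.decay_mul_le, Real.pi_lt_d2]

lemma ofReal_mass : ENNReal.ofReal T.mass = ∫⁻ x, ENNReal.ofReal (T.unnormalized θ x) := by
  rw [mass, ENNReal.ofReal_toReal, T.lintegral_unnormalized_eq]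
  exact ne_top_of_le_ne_top ENNReal.ofReal_ne_top (T.lintegral_unnormalized_le _)

lemma one_div_decay_le_mass : 1 / T.decay ≤ T.mass := by
  rw [← ENNReal.ofReal_le_ofReal_iff (q := T.mass) ENNReal.toReal_nonneg]
  exact (T.le_lintegral_unnormalized _).trans_eq (T.ofReal_mass fun _ => true).symm

lemma mass_le : T.mass ≤ 16 / T.decay := by
  rw [← ENNReal.ofReal_le_ofReal_iff (by have := T.decay_pos; positivity),
    T.ofReal_mass fun _ => true]
  exact T.lintegral_unnormalized_le _

lemma mass_pos : 0 < T.mass := (one_div_pos.2 T.decay_pos).trans_le T.one_div_decay_le_mass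

lemma density_pos (x : ℝ) : 0 < T.density θ x := div_pos (T.unnormalized_pos θ x) T.mass_pos

lemma isDensity_density : IsDensity (T.density θ) := by
  have hZ : 0 ≤ T.mass⁻¹ := inv_nonneg.2 T.mass_pos.le
  refine ⟨((T.continuous_unnormalized θ).div_const _).measurable,
    fun x => (T.density_pos θ x).le, ?_⟩
  simp only [density, div_eq_inv_mul, ENNReal.ofReal_mul hZ]
  rw [lintegral_const_mul' _ _ ENNReal.ofReal_ne_top, ← T.ofReal_mass θ, ← ENNReal.ofReal_mul hZ,
    inv_mul_cancel₀ T.mass_pos.ne', ENNReal.ofReal_one]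

lemma density_le (x : ℝ) : T.density θ x ≤ 2 * T.decay := by
  have unnormalized_le : T.unnormalized θ x ≤ 1 * 2 :=
    mul_le_mul (plateau_le_one _ _ _) (T.exp_le_two θ _) (Real.exp_pos _).le zero_le_one
  have one_le : 1 ≤ T.mass * T.decay := (div_le_iff₀ T.decay_pos).1 T.one_div_decay_le_mass
  rw [density, div_le_iff₀ T.mass_pos]
  linarith

lemma le_density {x : ℝ} (hx : x ∈ Set.Icc 0 (m * T.width)) :
    T.decay / 32 ≤ T.density θ x := by
  have mass_mul_le : T.mass * T.decay ≤ 16 := (le_div_iff₀ T.decay_pos).1 T.mass_le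
  rw [density, unnormalized, plateau_eq_one _ hx, one_mul, le_div_iff₀ T.mass_pos]
  linarith [T.half_le_exp θ (x / T.width)]

end Mass

section Score

lemma hasDerivAt_log_density (x : ℝ) :
    HasDerivAt (fun y => Real.log (T.density θ y))
      (plateauScore T.decay (overhang (m * T.width) x) +
        T.height / T.width * signSum bumpDeriv θ (x / T.width)) x := by
  have log_density : (fun y => Real.log (T.density θ y)) = fun y =>
      Real.log (plateau T.decay (m * T.width) y) + T.height * signSum bump θ (y / T.width) -
        Real.log T.mass := by
    funext y
    rw [density, Real.log_div (T.unnormalized_pos θ y).ne' T.mass_pos.ne', unnormalized,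
      Real.log_mul (plateau_pos _ _ _).ne' (Real.exp_pos _).ne', Real.log_exp]
  have bumps : HasDerivAt (fun y => signSum bump θ (y / T.width))
      (signSum bumpDeriv θ (x / T.width) * (1 / T.width)) x :=
    HasDerivAt.comp x (h₂ := signSum bump θ)
      (hasDerivAt_signSum hasDerivAt_bump θ (x / T.width)) ((hasDerivAt_id x).div_const T.width)
  rw [log_density]
  refine (((hasDerivAt_log_plateau T.decay T.span_nonneg x).add
    (bumps.const_mul T.height)).sub_const _).congr_deriv ?_
  ring

lemma score_density (x : ℝ) :
    score (T.density θ) x = plateauScore T.decay (overhang (m * T.width) x) +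
      T.height / T.width * signSum bumpDeriv θ (x / T.width) :=
  (T.hasDerivAt_log_density θ x).deriv

lemma score_density_of_mem {x : ℝ} (hx : x ∈ Set.Icc 0 (m * T.width)) :
    score (T.density θ) x = T.height / T.width * signSum bumpDeriv θ (x / T.width) := by
  simp [score_density, overhang_eq_zero hx, plateauScore]

lemma score_density_of_notMem {x : ℝ} (hx : x ∉ Set.Icc 0 (m * T.width)) :
    score (T.density θ) x = plateauScore T.decay (overhang (m * T.width) x) := by
  rw [score_density, signSum_div_eq_zero T.width_pos (fun _ => bumpDeriv_eq_zero) θ fun h =>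
    hx (Set.iUnion_subset (fun j => bin_subset_Icc T.width_pos.le j) h), mul_zero, add_zero]

lemma abs_mul_signSum_bumpDeriv_le (u : ℝ) :
    |T.height / T.width * signSum bumpDeriv θ u| ≤ T.height / T.width / 8 := by
  rw [abs_mul, abs_of_pos T.slope_pos, div_eq_mul_one_div (T.height / T.width)]
  exact mul_le_mul_of_nonneg_left (abs_signSum_le (fun _ => bumpDeriv_eq_zero) abs_bumpDeriv_le θ u)
    T.slope_pos.le

lemma abs_score_density_le (x : ℝ) :
    |score (T.density θ) x| ≤ T.decay + T.height / T.width / 8 := by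
  rw [score_density]
  exact (abs_add_le _ _).trans (add_le_add (abs_plateauScore_le T.decay_pos.le _)
    (T.abs_mul_signSum_bumpDeriv_le θ _))

lemma hasDerivAt_density (x : ℝ) :
    HasDerivAt (T.density θ) (T.density θ x * score (T.density θ) x) x := by
  have h := (T.hasDerivAt_log_density θ x).exp
  simpa only [Real.exp_log (T.density_pos θ _), ← score_density] using h

lemma locallyAbsCont_density : LocallyAbsCont (T.density θ) := by
  have ha := T.decay_pos
  have hs := T.slope_pos
  have deriv_le : ∀ x, ‖deriv (T.density θ) x‖₊ ≤
      (2 * T.decay * (T.decay + T.height / T.width / 8)).toNNReal := fun x => by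
    rw [← NNReal.coe_le_coe, coe_nnnorm, Real.coe_toNNReal _ (by positivity),
      (T.hasDerivAt_density θ x).deriv, Real.norm_eq_abs, abs_mul, abs_of_pos (T.density_pos θ x)]
    exact mul_le_mul (T.density_le θ x) (T.abs_score_density_le θ x) (abs_nonneg _) (by positivity)
  exact fun b c => (lipschitzWith_of_nnnorm_deriv_le
    (fun x => (T.hasDerivAt_density θ x).differentiableAt)
    deriv_le).lipschitzOnWith.absolutelyContinuousOnInterval

lemma ofReal_score_sq_mul_density_le (x : ℝ) :
    ENNReal.ofReal (score (T.density θ) x ^ 2 * T.density θ x) ≤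
      ENNReal.ofReal (T.decay ^ 2) * ENNReal.ofReal (T.density θ x) +
        (Set.Icc 0 (m * T.width)).indicator
          (fun _ => ENNReal.ofReal ((T.height / T.width) ^ 2 * T.decay)) x := by
  have ha := T.decay_pos
  have hs := T.slope_pos
  have hf := (T.density_pos θ x).le
  by_cases hx : x ∈ Set.Icc 0 (m * T.width)
  · have score_sq_le : score (T.density θ) x ^ 2 ≤ (T.height / T.width / 8) ^ 2 := by
      rw [T.score_density_of_mem θ hx]
      exact sq_le_sq' (abs_le.1 (T.abs_mul_signSum_bumpDeriv_le θ _)).1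
        (abs_le.1 (T.abs_mul_signSum_bumpDeriv_le θ _)).2
    rw [Set.indicator_of_mem hx]
    refine le_trans (ENNReal.ofReal_le_ofReal ?_) le_add_self
    calc
      _ ≤ (T.height / T.width / 8) ^ 2 * (2 * T.decay) :=
        mul_le_mul score_sq_le (T.density_le θ x) hf (by positivity)
      _ ≤ _ := by nlinarith [mul_nonneg (sq_nonneg (T.height / T.width)) ha.le]
  · rw [Set.indicator_of_notMem hx, add_zero, T.score_density_of_notMem θ hx,
      ← ENNReal.ofReal_mul (by positivity)]
    refine ENNReal.ofReal_le_ofReal (mul_le_mul_of_nonneg_right ?_ hf)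
    exact sq_le_sq' (abs_le.1 (abs_plateauScore_le ha.le _)).1
      (abs_le.1 (abs_plateauScore_le ha.le _)).2

lemma fisherInfo_density_le :
    fisherInfo (T.density θ) ≤
      ENNReal.ofReal (T.decay ^ 2 + (T.height / T.width) ^ 2 * (T.decay * (m * T.width))) := by
  have ha := T.decay_pos
  have hℓ := T.span_nonneg
  refine (lintegral_mono (T.ofReal_score_sq_mul_density_le θ)).trans_eq ?_
  rw [lintegral_add_left ((T.isDensity_density θ).1.ennreal_ofReal.const_mul _),
    lintegral_const_mul' _ _ ENNReal.ofReal_ne_top, (T.isDensity_density θ).2.2, mul_one,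
    lintegral_indicator measurableSet_Icc, setLIntegral_const, Real.volume_Icc, sub_zero,
    ← ENNReal.ofReal_mul (by positivity), ← ENNReal.ofReal_add (by positivity) (by positivity),
    mul_assoc]

end Score

section Holder

variable {β : ℝ}

lemma abs_score_density_sub_le (hβ : 1 ≤ β) (hβ' : β ≤ 2) (x y : ℝ) :
    |score (T.density θ) x - score (T.density θ) y| ≤
      (2 * T.decay ^ β + 6 * (T.height / T.width ^ β)) * |x - y| ^ (β - 1) := by
  have ha := T.decay_pos
  have hw := T.width_pos
  have hs := T.slope_pos
  have hγ : 0 ≤ β - 1 := by linarith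
  have tails : |plateauScore T.decay (overhang (m * T.width) x) -
      plateauScore T.decay (overhang (m * T.width) y)| ≤ 2 * T.decay ^ β * |x - y| ^ (β - 1) := by
    refine (abs_plateauScore_sub_le_rpow ha hβ hβ' _ _).trans ?_
    exact mul_le_mul_of_nonneg_left (Real.rpow_le_rpow (abs_nonneg _)
      (abs_overhang_sub_le T.span_nonneg x y) hγ) (by positivity)
  have bumps : |T.height / T.width * signSum bumpDeriv θ (x / T.width) -
      T.height / T.width * signSum bumpDeriv θ (y / T.width)| ≤
      6 * (T.height / T.width ^ β) * |x - y| ^ (β - 1) := by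
    have h := abs_signSum_bumpDeriv_sub_le_rpow hγ (by linarith) θ (x / T.width) (y / T.width)
    rw [← sub_div, abs_div, abs_of_pos hw, Real.div_rpow (abs_nonneg _) hw.le] at h
    rw [← mul_sub, abs_mul, abs_of_pos hs]
    refine (mul_le_mul_of_nonneg_left h hs.le).trans_eq ?_
    rw [Real.rpow_sub_one hw.ne']
    field_simp
  rw [score_density, score_density, add_sub_add_comm, add_mul]
  exact (abs_add_le _ _).trans (add_le_add tails bumps)

lemma density_mem_holderScoreFisherClass {L r : ℝ} (hβ : 1 ≤ β) (hβ' : β ≤ 2)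
    (hL : 2 * T.decay ^ β + 6 * (T.height / T.width ^ β) ≤ L)
    (hr : T.decay ^ 2 + (T.height / T.width) ^ 2 * (T.decay * (m * T.width)) ≤ r) :
    T.density θ ∈ holderScoreFisherClass β L r :=
  ⟨⟨T.isDensity_density θ, T.density_pos θ, T.locallyAbsCont_density θ,
    fun _ x => (T.hasDerivAt_log_density θ x).differentiableAt,
    fun x y _ _ => (T.abs_score_density_sub_le θ hβ hβ' x y).trans
      (mul_le_mul_of_nonneg_right hL (by positivity))⟩,
    (T.fisherInfo_density_le θ).trans (ENNReal.ofReal_le_ofReal hr)⟩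

end Holder

end TiltParams

lemma IsDensity.one_sub_le_hellingerAffinity {f g : ℝ → ℝ} (hf : IsDensity f) (hg : IsDensity g)
    {K v : ℝ} (hK : 0 ≤ K) (hv : 0 ≤ v) {B : Set ℝ} (hB : MeasurableSet B)
    (hBv : volume B ≤ ENNReal.ofReal v) (h_eq : ∀ x ∉ B, f x = g x)
    (h_le : ∀ x ∈ B, (√(f x) - √(g x)) ^ 2 ≤ K) :
    ENNReal.ofReal (1 - K * v / 2) ≤ hellingerAffinity volume (fun x => ENNReal.ofReal (f x))
      fun x => ENNReal.ofReal (g x) := by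
  set I := hellingerAffinity volume (fun x => ENNReal.ofReal (f x)) fun x => ENNReal.ofReal (g x)
  have add_le : ∀ x, ENNReal.ofReal (f x) + ENNReal.ofReal (g x) ≤
      2 * (ENNReal.ofReal (f x) * ENNReal.ofReal (g x)) ^ (1 / 2 : ℝ) +
        B.indicator (fun _ => ENNReal.ofReal K) x := by
    intro x
    have hfx := hf.2.1 x
    have hgx := hg.2.1 x
    have rpow_eq : (ENNReal.ofReal (f x) * ENNReal.ofReal (g x)) ^ (1 / 2 : ℝ) =
        ENNReal.ofReal (√(f x) * √(g x)) := by
      rw [← ENNReal.ofReal_mul hfx, ENNReal.ofReal_rpow_of_nonneg (mul_nonneg hfx hgx)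
        (by norm_num), ← Real.sqrt_eq_rpow, Real.sqrt_mul hfx]
    have add_eq : f x + g x = 2 * (√(f x) * √(g x)) + (√(f x) - √(g x)) ^ 2 := by
      linear_combination -Real.sq_sqrt hfx - Real.sq_sqrt hgx
    rw [rpow_eq, ← ENNReal.ofReal_add hfx hgx, add_eq, ENNReal.ofReal_add (by positivity)
      (sq_nonneg _), ENNReal.ofReal_mul zero_le_two, ENNReal.ofReal_ofNat]
    gcongr
    by_cases hx : x ∈ B
    · rw [Set.indicator_of_mem hx]
      exact ENNReal.ofReal_le_ofReal (h_le x hx)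
    · simp [h_eq x hx]
  have two_le : 2 ≤ 2 * I + ENNReal.ofReal (K * v) := by
    calc
      2 = ∫⁻ x, (ENNReal.ofReal (f x) + ENNReal.ofReal (g x)) := by
        rw [lintegral_add_left hf.1.ennreal_ofReal, hf.2.2, hg.2.2, one_add_one_eq_two]
      _ ≤ 2 * I + ENNReal.ofReal K * volume B := by
        refine (lintegral_mono add_le).trans_eq ?_
        rw [lintegral_add_right _ (measurable_const.indicator hB),
          lintegral_const_mul' _ _ ENNReal.ofNat_ne_top, lintegral_indicator hB, setLIntegral_const]
        rfl
      _ ≤ _ := by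
        rw [ENNReal.ofReal_mul hK]
        gcongr
  rcases eq_or_ne I ⊤ with hI | hI
  · exact hI ▸ le_top
  · rw [← ENNReal.ofReal_toReal hI, ← ENNReal.ofReal_ofNat, ← ENNReal.ofReal_mul zero_le_two,
      ← ENNReal.ofReal_add (by positivity) (by positivity),
      ENNReal.ofReal_le_ofReal_iff (by positivity)] at two_le
    exact ENNReal.ofReal_le_of_le_toReal (by linarith)

lemma four_mul_lt_one_sub_pow_sq {δ y : ℝ} {n : ℕ} (hδ : 0 < δ) (hδ' : δ < 1 / 16) (hy : 0 ≤ y)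
    (hy' : y ≤ 1 / 2) (hn : 8 * (n * y) ≤ Real.log (1 / δ)) : 4 * δ < ((1 - y) ^ n) ^ 2 := by
  have exp_le : Real.exp (-(2 * y)) ≤ 1 - y := by
    have hy₁ : 0 < 1 - y := by linarith
    rw [← Real.le_log_iff_exp_le hy₁]
    refine le_trans ?_ (Real.one_sub_inv_le_log_of_pos hy₁)
    rw [le_sub_iff_add_le, ← le_sub_iff_add_le', sub_neg_eq_add, inv_le_iff_one_le_mul₀ hy₁]
    nlinarith
  have sqrt_eq : √δ = Real.exp (-(Real.log (1 / δ) / 2)) := by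
    rw [one_div, Real.log_inv, neg_div, neg_neg, Real.exp_half, Real.exp_log hδ]
  calc
    4 * δ < √δ := Real.lt_sqrt_of_sq_lt (by nlinarith)
    _ ≤ Real.exp (((n * 2 : ℕ) : ℝ) * -(2 * y)) := by
      rw [sqrt_eq, Real.exp_le_exp]
      push_cast
      linarith
    _ = Real.exp (-(2 * y)) ^ (n * 2) := Real.exp_nat_mul _ _
    _ ≤ (1 - y) ^ (n * 2) := pow_le_pow_left₀ (Real.exp_pos _).le exp_le _
    _ = _ := pow_mul _ _ _

namespace TiltParams

variable {m n : ℕ} (T : TiltParams m) (θ θ' : Fin m → Bool)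

lemma abs_exp_half_sub_le (u v : ℝ) :
    |Real.exp (T.height * signSum bump θ u / 2) - Real.exp (T.height * signSum bump θ' v / 2)| ≤
      T.height := by
  have exp_sub_one_le (θ : Fin m → Bool) (u : ℝ) :
      |Real.exp (T.height * signSum bump θ u / 2) - 1| ≤ T.height / 16 := by
    have half_le : |T.height * signSum bump θ u / 2| ≤ T.height / 32 := by
      rw [abs_div, abs_two]
      linarith [T.abs_mul_signSum_bump_le θ u]
    linarith [Real.abs_exp_sub_one_le (half_le.trans (by linarith [T.height_le_one]))]
  rw [← sub_sub_sub_cancel_right _ _ (1 : ℝ)]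
  exact (abs_sub _ _).trans (by linarith [exp_sub_one_le θ u, exp_sub_one_le θ' v, T.height_pos])

lemma sqrt_density (x : ℝ) :
    √(T.density θ x) = √(plateau T.decay (m * T.width) x / T.mass) *
      Real.exp (T.height * signSum bump θ (x / T.width) / 2) := by
  rw [density, unnormalized, mul_div_right_comm, Real.exp_half,
    Real.sqrt_mul (div_pos (plateau_pos _ _ _) T.mass_pos).le]

lemma sqrt_density_sub_sq_le (x : ℝ) :
    (√(T.density θ x) - √(T.density θ' x)) ^ 2 ≤ T.decay * T.height ^ 2 := by
  have plateau_div_le : plateau T.decay (m * T.width) x / T.mass ≤ T.decay := by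
    rw [div_le_iff₀ T.mass_pos]
    exact (plateau_le_one _ _ _).trans ((div_le_iff₀' T.decay_pos).1 T.one_div_decay_le_mass)
  rw [sqrt_density, sqrt_density, ← mul_sub, mul_pow,
    Real.sq_sqrt (div_pos (plateau_pos _ _ _) T.mass_pos).le]
  exact mul_le_mul plateau_div_le
    (sq_le_sq.2 ((T.abs_exp_half_sub_le θ θ' _ _).trans_eq (abs_of_pos T.height_pos).symm))
    (sq_nonneg _) T.decay_pos.le

lemma le_hellingerAffinity_density {v : ℝ} (hv : 0 ≤ v) {B : Set ℝ} (hB : MeasurableSet B)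
    (hBv : volume B ≤ ENNReal.ofReal v)
    (h : ∀ x ∉ B, signSum bump θ (x / T.width) = signSum bump θ' (x / T.width)) :
    ENNReal.ofReal (1 - T.decay * T.height ^ 2 * v / 2) ≤
      hellingerAffinity volume (fun x => ENNReal.ofReal (T.density θ x))
        fun x => ENNReal.ofReal (T.density θ' x) :=
  (T.isDensity_density θ).one_sub_le_hellingerAffinity (T.isDensity_density θ')
    (mul_nonneg T.decay_pos.le (sq_nonneg _)) hv hB hBv
    (fun x hx => by rw [density, density, unnormalized, unnormalized, h x hx])
    fun x _ => T.sqrt_density_sub_sq_le θ θ' x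

lemma decay_mul_height_sq_mul_span_le : T.decay * T.height ^ 2 * (m * T.width) ≤ 1 / 4 := by
  have height_sq_le : T.height ^ 2 ≤ 1 := pow_le_one₀ T.height_pos.le T.height_le_one
  have := mul_nonneg T.decay_pos.le T.span_nonneg
  nlinarith [T.decay_mul_le]

/-- The score on the bins of the tilted density all of whose bumps have sign `b`. -/
noncomputable def binScore (b : Bool) (x : ℝ) : ℝ :=
  T.height / T.width * signSum bumpDeriv (fun _ : Fin m => b) (x / T.width)

lemma measurable_binScore (b : Bool) : Measurable (T.binScore b) :=
  ((continuous_signSum continuous_bumpDeriv _).measurable.comp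
    (measurable_id.div_const T.width)).const_mul _

lemma score_density_eq_binScore {j : Fin m} {x : ℝ} (hx : x ∈ bin T.width j) :
    score (T.density θ) x = T.binScore (θ j) x := by
  rw [T.score_density_of_mem θ (bin_subset_Icc T.width_pos.le j hx), binScore,
    signSum_div_of_mem_bin T.width_pos (fun _ => bumpDeriv_eq_zero) _ hx,
    signSum_div_of_mem_bin T.width_pos (fun _ => bumpDeriv_eq_zero) _ hx]

lemma setLIntegral_bin_binScore_sq (j : Fin m) :
    ∫⁻ x in bin T.width j,
        ENNReal.ofReal (T.decay / 32 * ((T.binScore true x - T.binScore false x) / 2) ^ 2) =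
      ENNReal.ofReal (T.decay * T.height ^ 2 / (5040 * T.width)) := by
  have ha := T.decay_pos
  have hw := T.width_pos
  set c := T.decay / 32 * (T.height / T.width) ^ 2 with hc
  have binScore_eq : ∀ x ∈ bin T.width j,
      ENNReal.ofReal (T.decay / 32 * ((T.binScore true x - T.binScore false x) / 2) ^ 2) =
        ENNReal.ofReal c * ENNReal.ofReal (bumpDeriv (x / T.width - (j : ℕ)) ^ 2) := fun x hx => by
    rw [← ENNReal.ofReal_mul (by positivity), binScore, binScore,
      signSum_div_of_mem_bin hw (fun _ => bumpDeriv_eq_zero) _ hx,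
      signSum_div_of_mem_bin hw (fun _ => bumpDeriv_eq_zero) _ hx]
    simp only [boolSign, cond_true, cond_false]
    rw [hc]
    ring_nf
  rw [setLIntegral_congr_fun (measurableSet_bin T.width j) binScore_eq,
    setLIntegral_bin_comp hw j fun u => ENNReal.ofReal c * ENNReal.ofReal (bumpDeriv u ^ 2),
    lintegral_const_mul' _ _ ENNReal.ofReal_ne_top, lintegral_bumpDeriv_sq,
    ← ENNReal.ofReal_mul (by positivity), ← ENNReal.ofReal_mul hw.le]
  congr 1
  rw [hc]
  field_simp
  ring

lemma setLIntegral_iUnion_bin_binScore_sq :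
    ∫⁻ x in ⋃ j : Fin m, bin T.width j,
        ENNReal.ofReal (T.decay / 32 * ((T.binScore true x - T.binScore false x) / 2) ^ 2) =
      ENNReal.ofReal (T.decay * T.height ^ 2 * m / (5040 * T.width)) := by
  simp only [lintegral_iUnion (fun j : Fin m => measurableSet_bin T.width j)
    (pairwise_disjoint_bin T.width_pos m), setLIntegral_bin_binScore_sq, tsum_fintype,
    Finset.sum_const, Finset.card_univ, Fintype.card_fin, nsmul_eq_mul]
  rw [← ENNReal.ofReal_natCast, ← ENNReal.ofReal_mul m.cast_nonneg]
  congr 1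
  ring

lemma three_quarters_le_test_errors (hn : n * (T.decay * T.height ^ 2 * T.width) ≤ 1 / 16)
    (j : Fin m) {S : Set (Fin n → ℝ)} (hS : MeasurableSet S) :
    3 / 4 ≤ (sampleLaw n (T.density θ)).real S +
      (sampleLaw n (T.density (Function.update θ j (!θ j)))).real Sᶜ := by
  set y := T.decay * T.height ^ 2 * T.width / 2 with hy
  have y_le : y ≤ 1 := by
    have one_le : (1 : ℝ) ≤ m := by exact_mod_cast j.pos
    have : T.width ≤ m * T.width := le_mul_of_one_le_left T.width_pos.le one_le
    have : T.decay * T.height ^ 2 * T.width ≤ T.decay * T.height ^ 2 * (m * T.width) :=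
      mul_le_mul_of_nonneg_left this (mul_nonneg T.decay_pos.le (sq_nonneg _))
    linarith [T.decay_mul_height_sq_mul_span_le]
  have affinity_le := T.le_hellingerAffinity_density θ (Function.update θ j (!θ j))
    T.width_pos.le (measurableSet_bin T.width j) (volume_bin T.width j).le fun x hx => by
      refine Finset.sum_congr rfl fun i _ => ?_
      by_cases hij : i = j
      · rw [hij, bump_eq_zero (mt (mem_bin_iff T.width_pos).2 hx), mul_zero, mul_zero]
      · rw [Function.update_of_ne hij]
  have bernoulli : 31 / 32 ≤ (1 - y) ^ n := by
    have := one_add_mul_le_pow (a := -y) (by linarith) n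
    have : n * -y = -(n * (T.decay * T.height ^ 2 * T.width)) / 2 := by rw [hy]; ring
    rw [← sub_eq_add_neg] at *
    linarith
  have sq_le := (T.isDensity_density θ).affinity_pow_sq_le_test_errors
    (T.isDensity_density (Function.update θ j (!θ j))) (sub_nonneg.2 y_le) affinity_le hS
  have : (31 / 32 : ℝ) ^ 2 ≤ ((1 - y) ^ n) ^ 2 := by gcongr
  nlinarith

lemma exists_sampleLaw_loss_le_of_bins (ψ : ScoreEstimator n) (hm : 0 < m)
    (hn : n * (T.decay * T.height ^ 2 * T.width) ≤ 1 / 16) {t : ℝ≥0}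
    (ht : (t : ℝ≥0∞) < ENNReal.ofReal (T.decay * T.height ^ 2 * m / (40320 * T.width))) :
    ∃ θ, (sampleLaw n (T.density θ)).real {X | ψ.loss (T.density θ) X ≤ t} ≤ 5 / 7 := by
  have ha := T.decay_pos
  have hw := T.width_pos
  have t_lt : (t : ℝ≥0∞) <
      ENNReal.ofReal (T.decay * T.height ^ 2 / (5040 * T.width)) * (⌈(m : ℝ) / 8⌉₊ : ℕ) := by
    refine ht.trans_le ?_
    rw [← ENNReal.ofReal_natCast, ← ENNReal.ofReal_mul (by positivity)]
    apply ENNReal.ofReal_le_ofReal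
    calc
      _ = T.decay * T.height ^ 2 / (5040 * T.width) * (m / 8) := by
        field_simp
        ring
      _ ≤ _ := by
        gcongr
        exact Nat.le_ceil _
  have ceil_le : ⌈(m : ℝ) / 8⌉₊ ≤ Fintype.card (Fin m) := by
    rw [Fintype.card_fin, Nat.ceil_le]
    linarith [m.cast_nonneg (α := ℝ)]
  obtain ⟨θ, hθ⟩ := ψ.exists_sampleLaw_loss_le (B := fun j : Fin m => bin T.width j)
    T.isDensity_density (by positivity : 0 ≤ T.decay / 32) T.measurable_binScore
    (fun j => measurableSet_bin T.width j) (pairwise_disjoint_bin hw m)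
    (fun θ j x hx => T.le_density θ (bin_subset_Icc hw.le j hx))
    (fun θ j x hx => T.score_density_eq_binScore θ hx)
    (fun j => (T.setLIntegral_bin_binScore_sq j).ge)
    (fun θ j S hS => T.three_quarters_le_test_errors θ hn j hS) ceil_le t_lt
  refine ⟨θ, ?_⟩
  rw [Fintype.card_fin] at hθ
  set p := (sampleLaw n (T.density θ)).real {X | ψ.loss (T.density θ) X ≤ t}
  have ceil_lt : (⌈(m : ℝ) / 8⌉₊ : ℝ) < m / 8 + 1 := Nat.ceil_lt_add_one (by positivity)
  have mul_le : m * (7 / 8 * p) ≤ m * (5 / 8) := by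
    nlinarith [measureReal_nonneg (μ := sampleLaw n (T.density θ))
      (s := {X | ψ.loss (T.density θ) X ≤ t})]
  linarith [le_of_mul_le_mul_left mul_le (by exact_mod_cast hm)]

lemma exists_sampleLaw_loss_lt_of_two_points (ψ : ScoreEstimator n) {δ : ℝ} (hδ : 0 < δ)
    (hδ' : δ < 1 / 16)
    (hn : 4 * (n * (T.decay * T.height ^ 2 * (m * T.width))) ≤ Real.log (1 / δ)) {t : ℝ≥0}
    (ht : (t : ℝ≥0∞) < ENNReal.ofReal (T.decay * T.height ^ 2 * m / (5040 * T.width))) :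
    ∃ θ, (sampleLaw n (T.density θ)).real {X | ψ.loss (T.density θ) X ≤ t} < 1 - δ := by
  set y := T.decay * T.height ^ 2 * (m * T.width) / 2 with hy
  have hy₀ : 0 ≤ y := div_nonneg (mul_nonneg (mul_nonneg T.decay_pos.le (sq_nonneg _))
    T.span_nonneg) zero_le_two
  have hy₁ : y ≤ 1 / 2 := by linarith [T.decay_mul_height_sq_mul_span_le]
  have measurable_union : MeasurableSet (⋃ j : Fin m, bin T.width j) :=
    .iUnion fun j => measurableSet_bin T.width j
  have union_subset : (⋃ j : Fin m, bin T.width j) ⊆ Set.Icc 0 (m * T.width) :=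
    Set.iUnion_subset fun j => bin_subset_Icc T.width_pos.le j
  have test_errors : ∀ (θ : Unit → Bool) (j : Unit) (S : Set (Fin n → ℝ)), MeasurableSet S →
      ((1 - y) ^ n) ^ 2 / 2 ≤ (sampleLaw n (T.density fun _ => θ ())).real S +
        (sampleLaw n (T.density fun _ => Function.update θ j (!θ j) ())).real Sᶜ := by
    intro θ j S hS
    have affinity_le := T.le_hellingerAffinity_density (fun _ => θ ())
      (fun _ => Function.update θ j (!θ j) ()) T.span_nonneg measurable_union
      (volume_iUnion_bin T.width_pos m).le fun x hx => by
        simp only [signSum_div_eq_zero T.width_pos (fun _ => bump_eq_zero) _ hx]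
    have half_le {q α : ℝ} (h : q ≤ α * (2 - α)) : q / 2 ≤ α := by nlinarith [sq_nonneg α]
    exact half_le ((T.isDensity_density _).affinity_pow_sq_le_test_errors (T.isDensity_density _)
      (sub_nonneg.2 (by linarith)) affinity_le hS)
  obtain ⟨θ, hθ⟩ := ψ.exists_sampleLaw_loss_le (k := 1)
    (f := fun θ : Unit → Bool => T.density fun _ => θ ()) (fun θ => T.isDensity_density _)
    (by linarith [T.decay_pos] : 0 ≤ T.decay / 32) T.measurable_binScore
    (fun _ => measurable_union) (fun i j hij => absurd (Subsingleton.elim i j) hij)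
    (fun θ _ x hx => T.le_density _ (union_subset hx))
    (fun θ _ x hx => T.score_density_of_mem _ (union_subset hx))
    (fun _ => T.setLIntegral_iUnion_bin_binScore_sq.ge) test_errors (by simp) (by simpa using ht)
  have four_mul_lt := four_mul_lt_one_sub_pow_sq hδ hδ' hy₀ hy₁ (n := n) (by rw [hy]; linarith)
  refine ⟨fun _ => θ (), ?_⟩
  simp only [Fintype.card_unit, Nat.cast_one, add_sub_cancel_right, one_mul] at hθ
  linarith

end TiltParams

namespace TiltParams

variable {m n : ℕ} (T : TiltParams m) {G : Set (ℝ → ℝ)} (hG : ∀ θ, T.density θ ∈ G) {δ : ℝ}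

include hG

lemma le_minimaxQuantile_of_bins (hm : 0 < m)
    (hn : n * (T.decay * T.height ^ 2 * T.width) ≤ 1 / 16) (hδ : δ < 1 / 4) :
    ENNReal.ofReal (T.decay * T.height ^ 2 * m / (40320 * T.width)) ≤ minimaxQuantile n δ G := by
  refine le_minimaxQuantile fun ψ t ht => ?_
  obtain ⟨θ, hθ⟩ := T.exists_sampleLaw_loss_le_of_bins ψ hm hn ht
  have := (T.isDensity_density θ).isProbabilityMeasure_sampleLaw n
  exact ⟨_, hG θ, (ENNReal.lt_ofReal_iff_toReal_lt (measure_ne_top _ _)).2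
    (hθ.trans_lt (by linarith))⟩

lemma le_minimaxQuantile_of_two_points (hδ : 0 < δ) (hδ' : δ < 1 / 16)
    (hn : 4 * (n * (T.decay * T.height ^ 2 * (m * T.width))) ≤ Real.log (1 / δ)) :
    ENNReal.ofReal (T.decay * T.height ^ 2 * m / (5040 * T.width)) ≤ minimaxQuantile n δ G := by
  refine le_minimaxQuantile fun ψ t ht => ?_
  obtain ⟨θ, hθ⟩ := T.exists_sampleLaw_loss_lt_of_two_points ψ hδ hδ' hn ht
  have := (T.isDensity_density θ).isProbabilityMeasure_sampleLaw n
  exact ⟨_, hG θ, (ENNReal.lt_ofReal_iff_toReal_lt (measure_ne_top _ _)).2 hθ⟩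

end TiltParams

lemma holderScoreFisherClass_mono (β L : ℝ) {s r : ℝ} (h : s ≤ r) :
    holderScoreFisherClass β L s ⊆ holderScoreFisherClass β L r :=
  fun _ hf => ⟨hf.1, hf.2.trans (ENNReal.ofReal_le_ofReal h)⟩

lemma minimaxQuantile_mono (n : ℕ) (δ : ℝ) {G H : Set (ℝ → ℝ)} (h : G ⊆ H) :
    minimaxQuantile n δ G ≤ minimaxQuantile n δ H :=
  iInf_mono fun _ => biSup_mono h

lemma minimaxRisk_mono (n : ℕ) {G H : Set (ℝ → ℝ)} (h : G ⊆ H) :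
    minimaxRisk n G ≤ minimaxRisk n H :=
  iInf_mono fun _ => biSup_mono h

lemma exists_nat_one_le_mul_rpow {x p q : ℝ} (hx : 0 < x) (hp : 0 < p) (hq : 0 ≤ q) (hq' : q ≤ 2) :
    ∃ m : ℕ, 0 < m ∧ 1 ≤ x * (m : ℝ) ^ p ∧ min (x ^ (q / p)) 1 / 4 ≤ (m : ℝ) ^ (-q) := by
  set y := x ^ (-p⁻¹) with hy
  have y_pos : 0 < y := Real.rpow_pos_of_pos hx _
  have y_rpow : y ^ p = x⁻¹ := by
    rw [hy, ← Real.rpow_mul hx.le, neg_mul, inv_mul_cancel₀ hp.ne', Real.rpow_neg_one]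
  have ceil_pos : 0 < ⌈y⌉₊ := Nat.ceil_pos.2 y_pos
  refine ⟨⌈y⌉₊, ceil_pos, ?_, ?_⟩
  · calc
      1 = x * y ^ p := by rw [y_rpow, mul_inv_cancel₀ hx.ne']
      _ ≤ _ := by
        gcongr
        exact Nat.le_ceil y
  · have ceil_le : (⌈y⌉₊ : ℝ) ≤ 2 * max y 1 := by
      linarith [Nat.ceil_lt_add_one y_pos.le, le_max_left y 1, le_max_right y 1]
    have quarter_le : (1 / 4 : ℝ) ≤ 2 ^ (-q) := by
      calc
        (1 / 4 : ℝ) = 2 ^ (-2 : ℝ) := by rw [Real.rpow_neg zero_le_two]; norm_num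
        _ ≤ 2 ^ (-q) := Real.rpow_le_rpow_of_exponent_le one_le_two (neg_le_neg hq')
    have min_le : min (x ^ (q / p)) 1 ≤ max y 1 ^ (-q) := by
      rcases le_total y 1 with h | h
      · rw [max_eq_right h, Real.one_rpow]
        exact min_le_right _ _
      · rw [max_eq_left h, hy, ← Real.rpow_mul hx.le, neg_mul_neg, inv_mul_eq_div]
        exact min_le_left _ _
    calc
      _ = 1 / 4 * min (x ^ (q / p)) 1 := by ring
      _ ≤ 2 ^ (-q) * max y 1 ^ (-q) := by gcongr
      _ = (2 * max y 1) ^ (-q) := (Real.mul_rpow zero_le_two (by positivity)).symm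
      _ ≤ _ := Real.rpow_le_rpow_of_nonpos (by exact_mod_cast ceil_pos) ceil_le (by linarith)

lemma min_add_le_min_add_min {u v c : ℝ} (hu : 0 ≤ u) (hv : 0 ≤ v) (hc : 0 ≤ c) :
    min (u + v) c ≤ min u c + min v c := by
  rcases le_total u c with h | h <;> rcases le_total v c with h' | h' <;>
    simp only [min_eq_left, min_eq_right, h, h'] <;>
    first
    | exact min_le_left _ _
    | exact (min_le_right _ _).trans (by linarith)

lemma min_rpow_add_rpow_le {x l p q : ℝ} (hx : 0 < x) (hl : 0 ≤ l) (hl' : l ≤ 3) (hp : 0 ≤ p)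
    (hpq : p ≤ q) (hq : q ≤ 1) :
    min (x ^ p + (x * l) ^ q) 1 ≤ 4 * min (x ^ p) 1 := by
  rcases le_total x 1 with h | h
  · rw [min_eq_left (Real.rpow_le_one hx.le h hp)]
    calc
      _ ≤ x ^ p + (x * l) ^ q := min_le_left _ _
      _ = x ^ p + x ^ q * l ^ q := by rw [Real.mul_rpow hx.le hl]
      _ ≤ x ^ p + x ^ p * 3 := by
        have hq₀ : 0 ≤ q := hp.trans hpq
        have x_le : x ^ q ≤ x ^ p := Real.rpow_le_rpow_of_exponent_ge hx h hpq
        have l_le : l ^ q ≤ 3 := by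
          calc
            l ^ q ≤ 3 ^ q := by gcongr
            _ ≤ (3 : ℝ) ^ (1 : ℝ) := Real.rpow_le_rpow_of_exponent_le (by norm_num) hq
            _ = 3 := Real.rpow_one 3
        gcongr
      _ = 4 * x ^ p := by ring
  · rw [min_eq_right (Real.one_le_rpow h hp)]
    exact (min_le_right _ _).trans (by norm_num)

lemma log_one_div_le_three {δ : ℝ} (hδ : 1 / 16 ≤ δ) : Real.log (1 / δ) ≤ 3 := by
  have hδ₀ : 0 < δ := by linarith
  calc
    Real.log (1 / δ) ≤ Real.log (2 ^ 4) := by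
      apply Real.log_le_log (by positivity)
      rw [div_le_iff₀ hδ₀]
      linarith
    _ = 4 * Real.log 2 := by rw [Real.log_pow, Nat.cast_ofNat]
    _ ≤ 3 := by linarith [Real.log_two_lt_d9]

section Rates

variable {β s σ : ℝ} (hβ : 1 ≤ β) (hs : 0 < s) (hσ : 0 < σ) (hsσ : s ≤ σ ^ 2)

/-- The hypercube inside the class with Hölder constant `σ ^ β` and Fisher information bound `s`.
The bins fill an interval of length `1 / σ`, and the decay rate `s / (4 * σ)` gives them a
proportion of order `s / σ ^ 2` of the mass. -/
noncomputable def scaledTilt {m : ℕ} (hm : 0 < m) : TiltParams m where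
  decay := s / (4 * σ)
  width := 1 / (σ * m)
  height := ((m : ℝ) ^ β)⁻¹ / 12
  decay_pos := by positivity
  width_pos := by positivity
  height_pos := by positivity
  height_le_one := by
    have := inv_le_one_of_one_le₀
      (Real.one_le_rpow (Nat.one_le_cast.2 hm : (1 : ℝ) ≤ m) (zero_le_one.trans hβ))
    linarith
  decay_mul_le := by
    have div_le : s / σ ^ 2 ≤ 1 := (div_le_one (by positivity)).2 hsσ
    have : s / (4 * σ) * (m * (1 / (σ * m))) = s / σ ^ 2 / 4 := by field_simp
    linarith

variable {m : ℕ} (hm : 0 < m)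

lemma scaledTilt_info :
    (scaledTilt hβ hs hσ hsσ hm).decay * (scaledTilt hβ hs hσ hsσ hm).height ^ 2 *
      (m * (scaledTilt hβ hs hσ hsσ hm).width) = s / (576 * σ ^ 2 * (m : ℝ) ^ (2 * β)) := by
  simp only [scaledTilt]
  rw [mul_comm 2 β, Real.rpow_mul m.cast_nonneg, Real.rpow_two]
  field_simp
  norm_num

lemma scaledTilt_separation :
    (scaledTilt hβ hs hσ hsσ hm).decay * (scaledTilt hβ hs hσ hsσ hm).height ^ 2 * m /
      (scaledTilt hβ hs hσ hsσ hm).width = s * (m : ℝ) ^ (-(2 * (β - 1))) / 576 := by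
  simp only [scaledTilt]
  have hm₀ : (0 : ℝ) < m := by exact_mod_cast hm
  rw [show -(2 * (β - 1)) = 2 - β * 2 by ring, Real.rpow_sub hm₀, Real.rpow_mul hm₀.le,
    Real.rpow_two, Real.rpow_two]
  field_simp
  norm_num

lemma scaledTilt_density_mem (hβ' : β ≤ 2) (θ : Fin m → Bool) :
    (scaledTilt hβ hs hσ hsσ hm).density θ ∈ holderScoreFisherClass β (σ ^ β) s := by
  have hm₀ : (0 : ℝ) < m := by exact_mod_cast hm
  have m_le : (m : ℝ) ≤ (m : ℝ) ^ β :=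
    Real.self_le_rpow_of_one_le (Nat.one_le_cast.2 hm) hβ
  have ratio_le : s / σ ^ 2 ≤ 1 := (div_le_one (by positivity)).2 hsσ
  apply TiltParams.density_mem_holderScoreFisherClass _ _ hβ hβ' <;> simp only [scaledTilt]
  · have decay_le : (s / (4 * σ)) ^ β ≤ σ ^ β / 4 := by
      calc
        (s / (4 * σ)) ^ β ≤ (σ * (1 / 4)) ^ β := by
          gcongr
          rw [div_le_iff₀ (by positivity)]
          linarith
        _ = σ ^ β * (1 / 4) ^ β := Real.mul_rpow hσ.le (by norm_num)
        _ ≤ σ ^ β * (1 / 4) := by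
          gcongr
          exact Real.rpow_le_self_of_le_one (by norm_num) (by norm_num) hβ
        _ = _ := by ring
    have height_eq : ((m : ℝ) ^ β)⁻¹ / 12 / (1 / (σ * m)) ^ β = σ ^ β / 12 := by
      rw [Real.div_rpow zero_le_one (by positivity), Real.one_rpow, Real.mul_rpow hσ.le hm₀.le]
      field_simp
    linarith
  · have slope_le : ((m : ℝ) ^ β)⁻¹ / 12 / (1 / (σ * m)) ≤ σ / 12 := by
      calc
        _ = σ / 12 * (m / (m : ℝ) ^ β) := by field_simp
        _ ≤ σ / 12 := mul_le_of_le_one_right (by positivity) ((div_le_one (by positivity)).2 m_le)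
    calc
      _ ≤ (s / (4 * σ)) ^ 2 + (σ / 12) ^ 2 * (s / (4 * σ) * (m * (1 / (σ * m)))) := by gcongr
      _ = s * (s / σ ^ 2) / 16 + s / 576 := by
        field_simp
        ring
      _ ≤ s := by nlinarith

include hβ hs hσ hsσ

lemma nonparametric_le_minimaxQuantile (hβ' : β ≤ 2) {n : ℕ} (hn : 0 < n) {δ : ℝ}
    (hδ : δ < 1 / 4) :
    ENNReal.ofReal (s / 10 ^ 8 *
      min ((σ ^ 2 / s * (1 / n)) ^ (2 * (β - 1) / (2 * β + 1))) 1) ≤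
      minimaxQuantile n δ (holderScoreFisherClass β (σ ^ β) s) := by
  obtain ⟨m, hm, one_le, min_le⟩ := exists_nat_one_le_mul_rpow (x := σ ^ 2 / s * (1 / n))
    (p := 2 * β + 1) (q := 2 * (β - 1)) (by positivity) (by linarith) (by linarith) (by linarith)
  set T := scaledTilt hβ hs hσ hsσ hm
  have info_le : n * (T.decay * T.height ^ 2 * T.width) ≤ 1 / 16 := by
    have hm₀ : (0 : ℝ) < m := by exact_mod_cast hm
    calc
      _ = n * (T.decay * T.height ^ 2 * (m * T.width)) / m := by field_simp
      _ = 1 / (σ ^ 2 / s * (1 / n) * (m : ℝ) ^ (2 * β + 1)) / 576 := by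
        rw [scaledTilt_info, Real.rpow_add_one hm₀.ne']
        field_simp
      _ ≤ 1 / 576 := by
        gcongr
        exact div_le_one_of_le₀ one_le (zero_le_one.trans one_le)
      _ ≤ 1 / 16 := by norm_num
  refine (ENNReal.ofReal_le_ofReal ?_).trans (T.le_minimaxQuantile_of_bins
    (scaledTilt_density_mem hβ hs hσ hsσ hm hβ') hm info_le hδ)
  rw [mul_comm 40320, ← div_div, scaledTilt_separation]
  have := mul_le_mul_of_nonneg_left min_le hs.le
  have : 0 ≤ s * (m : ℝ) ^ (-(2 * (β - 1))) := by positivity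
  linarith

lemma deviation_le_minimaxQuantile (hβ' : β ≤ 2) {n : ℕ} (hn : 0 < n) {δ : ℝ} (hδ : 0 < δ)
    (hδ' : δ < 1 / 16) :
    ENNReal.ofReal (s / 10 ^ 8 *
      min ((σ ^ 2 / s * (Real.log (1 / δ) / n)) ^ ((β - 1) / β)) 1) ≤
      minimaxQuantile n δ (holderScoreFisherClass β (σ ^ β) s) := by
  have log_pos : 0 < Real.log (1 / δ) := Real.log_pos (one_lt_one_div hδ (by linarith))
  obtain ⟨m, hm, one_le, min_le⟩ := exists_nat_one_le_mul_rpow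
    (x := σ ^ 2 / s * (Real.log (1 / δ) / n)) (p := 2 * β) (q := 2 * (β - 1)) (by positivity)
    (by linarith) (by linarith) (by linarith)
  rw [mul_div_mul_left _ _ two_ne_zero] at min_le
  set T := scaledTilt hβ hs hσ hsσ hm
  have info_le : 4 * (n * (T.decay * T.height ^ 2 * (m * T.width))) ≤ Real.log (1 / δ) := by
    calc
      _ = 1 / (σ ^ 2 / s * (Real.log (1 / δ) / n) * (m : ℝ) ^ (2 * β)) *
          (Real.log (1 / δ) / 144) := by
        rw [scaledTilt_info]
        field_simp
        norm_num
      _ ≤ 1 * (Real.log (1 / δ) / 144) := by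
        gcongr
        exact div_le_one_of_le₀ one_le (zero_le_one.trans one_le)
      _ ≤ _ := by linarith
  refine (ENNReal.ofReal_le_ofReal ?_).trans (T.le_minimaxQuantile_of_two_points
    (scaledTilt_density_mem hβ hs hσ hsσ hm hβ') hδ hδ' info_le)
  rw [mul_comm 5040, ← div_div, scaledTilt_separation]
  have := mul_le_mul_of_nonneg_left min_le hs.le
  have : 0 ≤ s * (m : ℝ) ^ (-(2 * (β - 1))) := by positivity
  linarith

lemma rate_le_minimaxQuantile (hβ' : β ≤ 2) {n : ℕ} (hn : 0 < n) {δ : ℝ} (hδ : 0 < δ)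
    (hδ' : δ < 1 / 4) :
    ENNReal.ofReal (1 / 10 ^ 9 * (s *
      min ((σ ^ 2 / s * (1 / n)) ^ (2 * (β - 1) / (2 * β + 1)) +
        (σ ^ 2 / s * (Real.log (1 / δ) / n)) ^ ((β - 1) / β)) 1)) ≤
      minimaxQuantile n δ (holderScoreFisherClass β (σ ^ β) s) := by
  have log_pos : 0 < Real.log (1 / δ) := Real.log_pos (one_lt_one_div hδ (by linarith))
  have nonparametric := nonparametric_le_minimaxQuantile hβ hs hσ hsσ hβ' hn hδ'
  set x := σ ^ 2 / s * (1 / n)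
  have mul_log : σ ^ 2 / s * (Real.log (1 / δ) / n) = x * Real.log (1 / δ) := by ring
  rcases lt_or_ge δ (1 / 16) with small | large
  · have deviation := deviation_le_minimaxQuantile hβ hs hσ hsσ hβ' hn hδ small
    rw [mul_log] at deviation ⊢
    set u := x ^ (2 * (β - 1) / (2 * β + 1))
    set v := (x * Real.log (1 / δ)) ^ ((β - 1) / β)
    have hu : 0 ≤ s / 10 ^ 8 * min u 1 := by positivity
    refine le_trans ?_ (max_le nonparametric deviation)
    rw [← ENNReal.ofReal_max]
    apply ENNReal.ofReal_le_ofReal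
    have := mul_le_mul_of_nonneg_left
      (min_add_le_min_add_min (u := u) (v := v) (by positivity) (by positivity) zero_le_one) hs.le
    linarith [le_max_left (s / 10 ^ 8 * min u 1) (s / 10 ^ 8 * min v 1),
      le_max_right (s / 10 ^ 8 * min u 1) (s / 10 ^ 8 * min v 1)]
  · have hx₀ : 0 < x := by positivity
    have min_le := min_rpow_add_rpow_le (p := 2 * (β - 1) / (2 * β + 1)) (q := (β - 1) / β) hx₀
      log_pos.le (log_one_div_le_three large) (div_nonneg (by linarith) (by linarith))
      (by rw [div_le_div_iff₀ (by linarith) (by linarith)]; nlinarith)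
      ((div_le_one (by linarith)).2 (by linarith))
    rw [mul_log]
    refine (ENNReal.ofReal_le_ofReal ?_).trans nonparametric
    have := mul_le_mul_of_nonneg_left min_le hs.le
    have : 0 ≤ s * min (x ^ (2 * (β - 1) / (2 * β + 1))) 1 := by positivity
    linarith

lemma rate_le_minimaxRisk (hβ' : β ≤ 2) {n : ℕ} (hn : 0 < n) :
    ENNReal.ofReal (1 / 10 ^ 9 * (s *
      min ((σ ^ 2 / s * (1 / n)) ^ (2 * (β - 1) / (2 * β + 1))) 1)) ≤
      minimaxRisk n (holderScoreFisherClass β (σ ^ β) s) := by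
  calc
    _ ≤ ENNReal.ofReal (1 / 5) * ENNReal.ofReal (s / 10 ^ 8 *
        min ((σ ^ 2 / s * (1 / n)) ^ (2 * (β - 1) / (2 * β + 1))) 1) := by
      rw [← ENNReal.ofReal_mul (by norm_num)]
      apply ENNReal.ofReal_le_ofReal
      have : 0 ≤ s * min ((σ ^ 2 / s * (1 / n)) ^ (2 * (β - 1) / (2 * β + 1))) 1 := by positivity
      linarith
    _ ≤ ENNReal.ofReal (1 / 5) *
        minimaxQuantile n (1 / 5) (holderScoreFisherClass β (σ ^ β) s) := by
      gcongr
      exact nonparametric_le_minimaxQuantile hβ hs hσ hsσ hβ' hn (by norm_num)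
    _ ≤ _ := ofReal_mul_minimaxQuantile_le_minimaxRisk (by norm_num) (by norm_num)
      fun f hf => hf.1.1

end Rates

theorem proposition6_general :
    ∃ c : ℝ, 0 < c ∧ ∀ β : ℝ, 1 ≤ β → β ≤ 2 → ∀ (L r : ℝ), 0 < L → 0 < r →
      ∀ r' : ℝ, r' = min r (L ^ (2 / β)) → ∀ n : ℕ, 1 ≤ n →
        (∀ δ : ℝ, 0 < δ → δ < 1 / 4 →
          ENNReal.ofReal (c * (r' * min
            ((L ^ (2 / β) / r' * (1 / (n : ℝ))) ^ (2 * (β - 1) / (2 * β + 1)) +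
              (L ^ (2 / β) / r' * (Real.log (1 / δ) / (n : ℝ))) ^ ((β - 1) / β)) 1))
            ≤ minimaxQuantile n δ (holderScoreFisherClass β L r)) ∧
        ENNReal.ofReal (c * (r' * min
            ((L ^ (2 / β) / r' * (1 / (n : ℝ))) ^ (2 * (β - 1) / (2 * β + 1))) 1))
          ≤ minimaxRisk n (holderScoreFisherClass β L r) := by
  refine ⟨1 / 10 ^ 9, by norm_num, fun β hβ hβ' L r hL hr r' hr' n hn => ?_⟩
  have hβ₀ : β ≠ 0 := by positivity
  obtain ⟨σ, hσ, rfl⟩ : ∃ σ, 0 < σ ∧ σ ^ β = L :=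
    ⟨L ^ β⁻¹, by positivity, Real.rpow_inv_rpow hL.le hβ₀⟩
  have rpow_eq_sq : (σ ^ β) ^ (2 / β) = σ ^ 2 := by
    rw [← Real.rpow_mul hσ.le, mul_div_cancel₀ _ hβ₀, Real.rpow_two]
  rw [rpow_eq_sq] at hr' ⊢
  have hs : 0 < r' := hr' ▸ lt_min hr (by positivity)
  have hsσ : r' ≤ σ ^ 2 := hr' ▸ min_le_right _ _
  have class_subset : holderScoreFisherClass β (σ ^ β) r' ⊆ holderScoreFisherClass β (σ ^ β) r :=
    holderScoreFisherClass_mono β _ (hr' ▸ min_le_left _ _)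
  exact ⟨fun δ hδ hδ' => (rate_le_minimaxQuantile hβ hs hσ hsσ hβ' hn hδ hδ').trans
      (minimaxQuantile_mono n δ class_subset),
    (rate_le_minimaxRisk hβ hs hσ hsσ hβ' hn).trans (minimaxRisk_mono n class_subset)⟩

theorem proposition6 (β : ℝ) (hβ : 1 ≤ β) (hβ' : β ≤ 2) :
    ∃ c : ℝ, 0 < c ∧ ∀ (L r : ℝ), 0 < L → 0 < r → ∀ r' : ℝ, r' = min r (L ^ (2 / β)) →
      ∀ n : ℕ, 1 ≤ n →
        (∀ δ : ℝ, 0 < δ → δ < 1 / 4 →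
          ENNReal.ofReal (c * (r' * min
            ((L ^ (2 / β) / r' * (1 / (n : ℝ))) ^ (2 * (β - 1) / (2 * β + 1)) +
              (L ^ (2 / β) / r' * (Real.log (1 / δ) / (n : ℝ))) ^ ((β - 1) / β)) 1))
            ≤ minimaxQuantile n δ (holderScoreFisherClass β L r)) ∧
        ENNReal.ofReal (c * (r' * min
            ((L ^ (2 / β) / r' * (1 / (n : ℝ))) ^ (2 * (β - 1) / (2 * β + 1))) 1))
          ≤ minimaxRisk n (holderScoreFisherClass β L r) :=
  let ⟨c, hc, h⟩ := proposition6_general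
  ⟨c, hc, h β hβ hβ'⟩
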